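/- Let $K$ be an algebraically closed field, let $N\ge 3$ be an integer, and let $e\in K$ be a primitive $N$-th root of unity (so the characteristic of $K$ does not divide $N$). Let $I=I^N_{0,1,\ldots,N-1}\subset R=K[x_0,\ldots,x_{N-1}]$ be the GT-system, i.e. the ideal generated by all forms $F$ of degree $N$ that are invariant under the diagonal matrix $\mathrm{diag}(1,e,e^2,\ldots,e^{N-1})$, that is, $F(x_0,ex_1,\ldots,e^{N-1}x_{N-1})=F(x_0,x_1,\ldots,x_{N-1})$. Call an ideal $J\subset R$ a *monomial Togliatti system* (of degree $N$) if $R/J$ is artinian, $J$ can be generated by monomials, $J$ is generated by $r\le\binom{2N-2}{N-2}$ forms of degree $N$, and $J$ fails the Weak Lefschetz Property in degree $N-1$: for every $L\in[R/J]_1$ the multiplication map $\times L:[R/J]_{N-1}\to[R/J]_N$ does not have maximal rank, i.e. is neither injective nor surjective. Call a monomial Togliatti system *minimal* if no proper subset of its set of minimal monomial generators generates a monomial Togliatti system of degree $N$. Then: 1. $I$ is a monomial Togliatti system. 2. If $I$ is minimal, then $N$ is a power of a prime. 3. If $K$ has characteristic $0$, then $I$ is minimal if and only if $N$ is a power of a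 prime. -/

import Mathlib

open MvPolynomial

namespace Togliatti

variable {K : Type*} [Field K] {n : ℕ}

/-- The graded piece `[R/I]_j` of the quotient of `R = K[x_0, …, x_{n-1}]` by an ideal `I`:
the classes of the forms of degree `j`. -/
noncomputable def gradedPiece (I : Ideal (MvPolynomial (Fin n) K)) (j : ℕ) :
    Submodule K (MvPolynomial (Fin n) K ⧸ I) :=
  (homogeneousSubmodule (Fin n) K j).map (Ideal.Quotient.mkₐ K I).toLinearMap

theorem mul_mem_gradedPiece (I : Ideal (MvPolynomial (Fin n) K)) (j : ℕ)
    {L a : MvPolynomial (Fin n) K ⧸ I} (hL : L ∈ gradedPiece I 1) (ha : a ∈ gradedPiece I j) :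
    L * a ∈ gradedPiece I (j + 1) := by
  obtain ⟨p, hp, rfl⟩ := hL
  obtain ⟨q, hq, rfl⟩ := ha
  refine ⟨p * q, ?_, by simp⟩
  have hp' : p.IsHomogeneous 1 := hp
  have hq' : q.IsHomogeneous j := hq
  have h := hp'.mul hq'
  rw [add_comm] at h
  exact h

/-- Multiplication by `L ∈ [R/I]_1` as a `K`-linear map `[R/I]_j → [R/I]_{j+1}`. -/
noncomputable def mulMap (I : Ideal (MvPolynomial (Fin n) K)) (L : gradedPiece I 1) (j : ℕ) :
    gradedPiece I j →ₗ[K] gradedPiece I (j + 1) :=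
  (LinearMap.mulLeft K (L : MvPolynomial (Fin n) K ⧸ I)).restrict
    (fun _ ha => mul_mem_gradedPiece I j L.2 ha)

/-- `I` fails the Weak Lefschetz Property in degree `j`: for no `L ∈ [R/I]_1` does the
multiplication map `×L : [R/I]_j → [R/I]_{j+1}` have maximal rank, that is, for no `L` is it
injective or surjective. -/
def FailsWLPInDegree (I : Ideal (MvPolynomial (Fin n) K)) (j : ℕ) : Prop :=
  ∀ L : gradedPiece I 1,
    ¬ (Function.Injective (mulMap I L j) ∨ Function.Surjective (mulMap I L j))

/-- `I` is a Togliatti system of forms of degree `d` in `n ≥ 2` variables: an artinian ideal that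
is generated by `r ≤ binom (n + d - 2) (n - 2)` forms of degree `d ≥ 1` and fails the Weak
Lefschetz Property in degree `d - 1`. -/
def IsTogliattiSystem (I : Ideal (MvPolynomial (Fin n) K)) (d : ℕ) : Prop :=
  IsArtinianRing (MvPolynomial (Fin n) K ⧸ I) ∧
  (∃ (r : ℕ) (F : Fin r → MvPolynomial (Fin n) K),
    (∀ i, (F i).IsHomogeneous d) ∧ Ideal.span (Set.range F) = I ∧
    r ≤ (n + d - 2).choose (n - 2)) ∧
  FailsWLPInDegree I (d - 1)

variable (K) in
/-- The ideal of `K[x_0, …, x_{n-1}]` generated by the monomials with exponent vectors in `S`. -/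
noncomputable def monomialIdeal (S : Set (Fin n →₀ ℕ)) : Ideal (MvPolynomial (Fin n) K) :=
  Ideal.span ((fun m => monomial m (1 : K)) '' S)

/-- A monomial Togliatti system: a Togliatti system that can be generated by monomials. -/
def IsMonomialTogliattiSystem (I : Ideal (MvPolynomial (Fin n) K)) (d : ℕ) : Prop :=
  IsTogliattiSystem I d ∧ ∃ S : Set (Fin n →₀ ℕ), I = monomialIdeal K S

/-- The exponent vectors of the minimal monomial generators of a monomial ideal `I`: the monomials
of `I` that are minimal under divisibility among the monomials of `I`. -/
def minimalMonomialGenerators (I : Ideal (MvPolynomial (Fin n) K)) : Set (Fin n →₀ ℕ) :=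
  {m | Minimal (fun m' : Fin n →₀ ℕ => monomial m' (1 : K) ∈ I) m}

/-- A minimal monomial Togliatti system: no proper subset of the set of its (minimal monomial)
generators generates a monomial Togliatti system. -/
def IsMinimalMonomialTogliattiSystem (I : Ideal (MvPolynomial (Fin n) K)) (d : ℕ) : Prop :=
  IsMonomialTogliattiSystem I d ∧
  ∀ S : Set (Fin n →₀ ℕ), S ⊂ minimalMonomialGenerators I →
    ¬ IsMonomialTogliattiSystem (monomialIdeal K S) d

/-- The action on polynomials of the diagonal matrix
`M(α_0, …, α_{n-1}) = diag (e ^ α_0, …, e ^ α_{n-1})`, substituting `e ^ α_i * x_i` for `x_i`. -/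
noncomputable def diagonalAction (e : K) (α : Fin n → ℕ) :
    MvPolynomial (Fin n) K →ₐ[K] MvPolynomial (Fin n) K :=
  aeval (fun i => C (e ^ α i) * X i)

/-- The GT-system `I^d_{α_0, …, α_{n-1}}`, with `e` a primitive `d`-th root of unity: the ideal
generated by all forms of degree `d` invariant under the action of `M(α_0, …, α_{n-1})`. -/
noncomputable def gtSystem (e : K) (d : ℕ) (α : Fin n → ℕ) : Ideal (MvPolynomial (Fin n) K) :=
  Ideal.span {F | F.IsHomogeneous d ∧ diagonalAction e α F = F}

end Togliatti

/-!
The argument rests on the product `D` of the conjugates `∑ j, e ^ (r * j) * x_j`, `0 ≤ r < N`, of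
the linear form `∑ j, x_j` (`circulantForm`, the determinant of the generic circulant matrix). It
is an invariant form of degree `N`, and the GT-system is the ideal generated by the invariant
monomials of degree `N` (`gtSystem_eq_monomialIdeal`).

Let `J` be generated by a set `S` of invariant monomials. If `J` fails the Weak Lefschetz Property,
then `∑ j, x_j` times some form of degree `N - 1` is a nonzero form of `J`; being invariant, it is
divisible by all the conjugates, hence a scalar multiple of `D`, and so `S` contains all the
monomials of `D` (`mem_of_failsWLPInDegree`). Conversely, if `S` contains the monomials of `D`, then
any linear form `L` is killed by the product of its other conjugates, because rescaling the
variables of `D` does not change its monomials; surjectivity is excluded by a dimension count,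
which needs the bound on the number of invariant monomials
(`isMonomialTogliattiSystem_of_support_subset`, `card_invariantExponents_le`). So the GT-system is
a Togliatti system, and it is minimal exactly when no invariant monomial has coefficient zero in
`D` (`isMinimal_gtSystem_iff`).

The coefficients of `D` are the coefficients of the elementary symmetric functions of the linear
forms with one variable `x_t` removed. Newton's identities, in which the power sums contain only
monomials of weight divisible by `N`, give a recursion for them over the splittings of a monomial
into invariant parts (`degree_mul_labelledCoeff`). In this recursion each further part contributes
a factor `N`.

* If `N = p ^ r`, the term of the trivial splitting dominates `p`-adically, because
  `a * (k choose a)` is not divisible by `p ^ r` for `1 ≤ a ≤ k < p ^ r`. So no coefficient vanishes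
  in characteristic zero (`exists_padicNorm_eq_one`).
* If `N` is not a prime power, a nontrivial idempotent `n ≤ N / 2` modulo `N` yields a monomial
  with only one nontrivial splitting, whose two terms cancel because `N` divides `n * (n - 1)`
  (`labelledCoeff_eq_zero`, `exists_coeff_truncEsymm_eq_zero`). The vanishing passes from `ℂ` to
  all fields through the cyclotomic polynomial (`coeff_circulantForm_eq_zero_of_charZero`).
-/

namespace Togliatti

/-! ### A recursion for products of linear forms -/

section Recursion

variable {R σ : Type*} [CommRing R] [Fintype σ] [DecidableEq σ]

/-- The linear form `∑ j, e ^ (r * w j) * x_j`. -/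
noncomputable def linForm (e : R) (w : σ → ℕ) (r : ℕ) : MvPolynomial σ R :=
  ∑ j, C (e ^ (r * w j)) * X j

/-- The linear form `∑ j, e ^ (r * w j) * x_j` without its term in `x_t`. -/
noncomputable def truncForm (e : R) (w : σ → ℕ) (t : σ) (r : ℕ) : MvPolynomial σ R :=
  ∑ j, (if j = t then 0 else e ^ (r * w j)) • X j

/-- The `k`-th elementary symmetric function of the truncated linear forms with `0 ≤ r < N`. -/
noncomputable def truncEsymm (N : ℕ) (e : R) (w : σ → ℕ) (t : σ) (k : ℕ) : MvPolynomial σ R :=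
  ∑ s ∈ Finset.powersetCard k (Finset.univ : Finset (Fin N)), ∏ r ∈ s, truncForm e w t r

theorem aeval_truncForm_esymm (N : ℕ) (e : R) (w : σ → ℕ) (t : σ) (k : ℕ) :
    aeval (fun r : Fin N => truncForm e w t r) (esymm (Fin N) R k) = truncEsymm N e w t k := by
  simp [esymm, truncEsymm]

theorem sum_pow_mul_primitiveRoot [IsDomain R] {N : ℕ} {e : R} (he : IsPrimitiveRoot e N) (s : ℕ) :
    ∑ r : Fin N, e ^ ((r : ℕ) * s) = if N ∣ s then (N : R) else 0 := by
  rw [Fin.sum_univ_eq_sum_range (fun r => e ^ (r * s)) N]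
  simp_rw [mul_comm _ s, pow_mul]
  split_ifs with h
  · simp [(he.pow_eq_one_iff_dvd s).2 h]
  · have h1 : e ^ s - 1 ≠ 0 := sub_ne_zero.2 fun hh => h ((he.pow_eq_one_iff_dvd s).1 hh)
    have h2 := mul_geom_sum (e ^ s) N
    rw [← pow_mul, mul_comm s, pow_mul, he.pow_eq_one, one_pow, sub_self] at h2
    exact (mul_eq_zero.1 h2).resolve_left h1

theorem coeff_truncForm_pow (e : R) (w : σ → ℕ) {t : σ} (r : ℕ) {v : σ →₀ ℕ} (hv : v t = 0) :
    coeff v (truncForm e w t r ^ v.degree) = v.multinomial * e ^ (r * Finsupp.weight w v) := by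
  rw [truncForm, coeff_linearCombination_X_pow_of_fintype,
    if_pos (by rw [Finsupp.degree_apply]; rfl)]
  congr 1
  rw [Finsupp.weight_apply, Finsupp.sum, Finset.mul_sum, ← Finset.prod_pow_eq_pow_sum,
    Finsupp.prod]
  refine Finset.prod_congr rfl fun i hi => ?_
  have : i ≠ t := by rintro rfl; simp [hv] at hi
  rw [if_neg this, ← pow_mul, smul_eq_mul]
  ring_nf

/-- The power sums of the truncated linear forms contain only monomials whose weight is divisible
by `N`. -/
theorem coeff_sum_truncForm_pow [IsDomain R] {N : ℕ} {e : R} (he : IsPrimitiveRoot e N)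
    (w : σ → ℕ) {t : σ} {v : σ →₀ ℕ} (hv : v t = 0) :
    coeff v (∑ r : Fin N, truncForm e w t r ^ v.degree) =
      if N ∣ Finsupp.weight w v then (N * v.multinomial : R) else 0 := by
  simp_rw [coeff_sum, coeff_truncForm_pow e w _ hv, ← Finset.mul_sum]
  rw [sum_pow_mul_primitiveRoot he]
  split_ifs <;> ring

theorem truncForm_isHomogeneous (e : R) (w : σ → ℕ) (t : σ) (r : ℕ) :
    (truncForm e w t r).IsHomogeneous 1 := by
  refine IsHomogeneous.sum _ _ _ fun j _ => ?_
  rw [smul_eq_C_mul]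
  exact (isHomogeneous_X R j).C_mul _

theorem truncEsymm_isHomogeneous (N : ℕ) (e : R) (w : σ → ℕ) (t : σ) (k : ℕ) :
    (truncEsymm N e w t k).IsHomogeneous k := by
  refine IsHomogeneous.sum _ _ _ fun s hs => ?_
  have h := IsHomogeneous.prod s (fun r : Fin N => truncForm e w t r) (fun _ => 1)
    fun r _ => truncForm_isHomogeneous e w t r
  rwa [Finset.sum_const, (Finset.mem_powersetCard.1 hs).2, smul_eq_mul, mul_one] at h

theorem coeff_truncEsymm_of_ne_zero (N : ℕ) (e : R) (w : σ → ℕ) {t : σ} (k : ℕ) {v : σ →₀ ℕ}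
    (hv : v t ≠ 0) : coeff v (truncEsymm N e w t k) = 0 := by
  have h : truncEsymm N e w t k ∈ supported R {t}ᶜ := by
    refine Subalgebra.sum_mem _ fun s _ => Subalgebra.prod_mem _ fun r _ =>
      Subalgebra.sum_mem _ fun j _ => ?_
    split_ifs with hj
    · simp
    · exact Subalgebra.smul_mem _ (show X j ∈ Algebra.adjoin R _ from
        Algebra.subset_adjoin (Set.mem_image_of_mem _ hj)) _
  by_contra hc
  exact mem_supported.1 h ((mem_vars_iff_mem_support t).2
    ⟨v, mem_support_iff.2 hc, Finsupp.mem_support_iff.2 hv⟩) rfl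

/-- Newton's identities for the truncated linear forms, coefficient by coefficient: a recursion
for the coefficients of their elementary symmetric functions over the splittings of a monomial. -/
theorem degree_mul_coeff_truncEsymm [IsDomain R] {N : ℕ} {e : R} (he : IsPrimitiveRoot e N)
    (w : σ → ℕ) {t : σ} {m : σ →₀ ℕ} (hm : m t = 0) :
    (m.degree : R) * coeff m (truncEsymm N e w t m.degree) =
      ∑ x ∈ Finset.HasAntidiagonal.antidiagonal m with x.2 ≠ 0 ∧ N ∣ Finsupp.weight w x.2,
        (-1) ^ (x.2.degree + 1) * (N * x.2.multinomial) *
          coeff x.1 (truncEsymm N e w t x.1.degree) := by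
  have h := congrArg (aeval (fun r : Fin N => truncForm e w t r))
    (mul_esymm_eq_sum (Fin N) R m.degree)
  simp only [map_mul, map_natCast, map_pow, map_neg, map_one, map_sum, psum, aeval_X,
    aeval_truncForm_esymm] at h
  have h := congrArg (coeff m) h
  rw [← C_eq_coe_nat, coeff_C_mul] at h
  rw [h, Finset.mul_sum, coeff_sum]
  -- By homogeneity, only the splittings `m = u + v` with `(|u|, |v|) = a` contribute to the
  -- coefficient of `m` in the summand of index `a`.
  have key : ∀ a ∈ Finset.HasAntidiagonal.antidiagonal m.degree,
      coeff m ((-1) ^ (m.degree + 1) * ((-1) ^ a.1 * truncEsymm N e w t a.1 *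
        ∑ r : Fin N, truncForm e w t r ^ a.2)) =
      ∑ x ∈ Finset.HasAntidiagonal.antidiagonal m with (x.1.degree, x.2.degree) = a,
        if N ∣ Finsupp.weight w x.2 then
        (-1) ^ (x.2.degree + 1) * (N * x.2.multinomial) *
          coeff x.1 (truncEsymm N e w t x.1.degree) else 0 := by
    intro a ha
    rw [Finset.HasAntidiagonal.mem_antidiagonal] at ha
    have hs : ((-1) ^ (m.degree + 1) * ((-1) ^ a.1 * truncEsymm N e w t a.1 *
        ∑ r : Fin N, truncForm e w t r ^ a.2) : MvPolynomial σ R) =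
        C ((-1) ^ (a.2 + 1)) * (truncEsymm N e w t a.1 * ∑ r : Fin N, truncForm e w t r ^ a.2) := by
      rw [← ha, map_pow, map_neg, C_1]
      have : ((-1) ^ (a.1 + a.2 + 1) * (-1) ^ a.1 : MvPolynomial σ R) = (-1) ^ (a.2 + 1) := by
        rw [← pow_add, show a.1 + a.2 + 1 + a.1 = 2 * a.1 + (a.2 + 1) by ring, pow_add, pow_mul]
        simp
      rw [← this]; ring
    rw [hs, coeff_C_mul, coeff_mul, Finset.mul_sum, Finset.sum_filter]
    refine Finset.sum_congr rfl fun x hx => ?_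
    rw [Finset.HasAntidiagonal.mem_antidiagonal] at hx
    have hx2 : x.2 t = 0 := by
      have := DFunLike.congr_fun hx t
      simp only [Finsupp.add_apply] at this; omega
    have hd : x.1.degree + x.2.degree = m.degree := by rw [← hx, map_add]
    by_cases hc : (x.1.degree, x.2.degree) = a
    · rw [if_pos hc, ← hc, coeff_sum_truncForm_pow he w hx2]
      split_ifs <;> ring
    · rw [if_neg hc, (truncEsymm_isHomogeneous N e w t a.1).coeff_eq_zero, zero_mul, mul_zero]
      intro h1; exact hc (Prod.ext h1 (by simp only; omega))
  rw [Finset.sum_congr rfl fun a ha => key a (Finset.mem_filter.1 ha).1, ← Finset.filter_filter,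
    Finset.sum_filter (fun x : (σ →₀ ℕ) × (σ →₀ ℕ) => N ∣ Finsupp.weight w x.2)]
  have hdeg : ∀ x ∈ Finset.HasAntidiagonal.antidiagonal m, x.1.degree + x.2.degree = m.degree :=
    fun x hx => by rw [← map_add, Finset.HasAntidiagonal.mem_antidiagonal.1 hx]
  have hne : ∀ x : (σ →₀ ℕ) × (σ →₀ ℕ), x.2 ≠ 0 ↔ 0 < x.2.degree := fun x => by
    rw [Nat.pos_iff_ne_zero, ne_eq, ne_eq, Finsupp.degree_eq_zero_iff]
  rw [← Finset.sum_fiberwise_of_maps_to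
    (g := fun x : (σ →₀ ℕ) × (σ →₀ ℕ) => (x.1.degree, x.2.degree))
    (t := (Finset.HasAntidiagonal.antidiagonal m.degree).filter fun a => a.1 < m.degree)]
  · refine Finset.sum_congr rfl fun a ha => ?_
    rw [Finset.filter_filter]
    refine Finset.sum_congr (Finset.filter_congr fun x hx => ?_) fun _ _ => rfl
    have h1 := (Finset.mem_filter.1 ha).2
    have h2 := hdeg x hx
    rw [hne]
    constructor
    · rintro rfl
      exact ⟨by simp only at h1; omega, rfl⟩
    · exact fun h => h.2
  · intro x hx
    rw [Finset.mem_filter, hne] at hx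
    have h2 := hdeg x hx.1
    rw [Finset.mem_filter, Finset.HasAntidiagonal.mem_antidiagonal]
    exact ⟨h2, by simp only; omega⟩

/-- The coefficient of the monomial `m` in the elementary symmetric function of its degree, times
the product of the factorials of the exponents: a signed count in which the factors of the monomial
are told apart, so that no multinomial coefficients occur. -/
noncomputable def labelledCoeff (N : ℕ) (e : R) (w : σ → ℕ) (t : σ) (m : σ →₀ ℕ) : R :=
  (∏ i, ((m i).factorial : R)) * coeff m (truncEsymm N e w t m.degree)

theorem labelledCoeff_zero (N : ℕ) (e : R) (w : σ → ℕ) (t : σ) :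
    labelledCoeff N e w t 0 = 1 := by
  simp [labelledCoeff, truncEsymm]

omit [DecidableEq σ] in
theorem prod_factorial_mul_multinomial (v : σ →₀ ℕ) :
    (∏ i, (v i).factorial) * v.multinomial = v.degree.factorial := by
  rw [Finsupp.multinomial_eq_of_support_subset (Finset.subset_univ v.support),
    Nat.multinomial_spec, Finsupp.degree_eq_sum]

/-- The recursion for the coefficients of elementary symmetric functions, freed of denominators. -/
theorem degree_mul_labelledCoeff [IsDomain R] {N : ℕ} {e : R} (he : IsPrimitiveRoot e N)
    (w : σ → ℕ) {t : σ} {m : σ →₀ ℕ} (hm : m t = 0) :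
    (m.degree : R) * labelledCoeff N e w t m =
      ∑ x ∈ Finset.HasAntidiagonal.antidiagonal m with x.2 ≠ 0 ∧ N ∣ Finsupp.weight w x.2,
        (-1) ^ (x.2.degree + 1) * N * (∏ i, ((m i).choose (x.2 i) : R)) *
          (x.2.degree.factorial : R) * labelledCoeff N e w t x.1 := by
  rw [labelledCoeff, mul_left_comm, degree_mul_coeff_truncEsymm he w hm, Finset.mul_sum]
  refine Finset.sum_congr rfl fun x hx => ?_
  have hx := Finset.HasAntidiagonal.mem_antidiagonal.1 (Finset.mem_filter.1 hx).1
  have h1 : (∏ i, (m i).factorial : ℕ) =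
      (∏ i, (m i).choose (x.2 i)) * (∏ i, (x.2 i).factorial) * ∏ i, (x.1 i).factorial := by
    rw [← Finset.prod_mul_distrib, ← Finset.prod_mul_distrib]
    refine Finset.prod_congr rfl fun i _ => ?_
    rw [← hx, Finsupp.add_apply, ← Nat.choose_mul_factorial_mul_factorial
      (Nat.le_add_left (x.2 i) (x.1 i)), Nat.add_sub_cancel]
  have h2 := congrArg (Nat.cast : ℕ → R) (prod_factorial_mul_multinomial x.2)
  have h1 := congrArg (Nat.cast : ℕ → R) h1
  push_cast at h1 h2
  rw [h1, labelledCoeff, ← h2]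
  ring

/-- Expansion of the product of the linear forms along the variable `x_t`, when this variable has
coefficient `1` in all of them. -/
theorem prod_linForm_eq_sum (N : ℕ) {e : R} (he : e ^ N = 1) {w : σ → ℕ} {t : σ} (hw : N ∣ w t) :
    ∏ r : Fin N, linForm e w r =
      ∑ k ∈ Finset.range (N + 1), truncEsymm N e w t k * monomial (Finsupp.single t (N - k)) 1 := by
  have h1 : ∀ r : ℕ, linForm e w r = truncForm e w t r + X t := fun r => by
    rw [linForm, truncForm, ← Finset.add_sum_erase _ _ (Finset.mem_univ t),
      ← Finset.add_sum_erase _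
        (fun j => (if j = t then 0 else e ^ (r * w j)) • (X j : MvPolynomial σ R))
        (Finset.mem_univ t), if_pos rfl, zero_smul, zero_add, add_comm]
    obtain ⟨c, hc⟩ := hw
    congr 1
    · refine Finset.sum_congr rfl fun j hj => ?_
      rw [if_neg (by simpa using hj), smul_eq_C_mul]
    · rw [hc, mul_left_comm, pow_mul, he, one_pow, C_1, one_mul]
  simp_rw [h1]
  rw [Finset.prod_add, Finset.sum_powerset, Finset.card_univ, Fintype.card_fin]
  refine Finset.sum_congr rfl fun k _ => ?_
  rw [truncEsymm, Finset.sum_mul]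
  refine Finset.sum_congr rfl fun s hs => ?_
  rw [Finset.prod_const, Finset.card_sdiff_of_subset (Finset.subset_univ s),
    (Finset.mem_powersetCard.1 hs).2, Finset.card_univ, Fintype.card_fin, X_pow_eq_monomial]

theorem coeff_prod_linForm {N : ℕ} {e : R} (he : e ^ N = 1) {w : σ → ℕ} {t : σ}
    (hw : N ∣ w t) {m : σ →₀ ℕ} (hm : m.degree = N) :
    coeff m (∏ r : Fin N, linForm e w r) =
      coeff (m.erase t) (truncEsymm N e w t (m.erase t).degree) := by
  have hd : (m.erase t).degree + m t = N := by
    conv_rhs => rw [← hm, ← Finsupp.erase_add_single t m, map_add, Finsupp.degree_single]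
  rw [prod_linForm_eq_sum N he hw, coeff_sum, Finset.sum_eq_single (m.erase t).degree]
  · have h1 := coeff_mul_monomial (R := R) (m.erase t) (Finsupp.single t (m t)) 1
      (truncEsymm N e w t (m.erase t).degree)
    rwa [Finsupp.erase_add_single, mul_one, show m t = N - (m.erase t).degree by omega] at h1
  · intro k hk hne
    rw [coeff_mul_monomial']
    split_ifs with hle
    · rw [coeff_truncEsymm_of_ne_zero, zero_mul]
      have h1 : N - k ≤ m t := by simpa using hle t
      rw [Finset.mem_range] at hk
      simp only [Finsupp.tsub_apply, Finsupp.single_eq_same]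
      omega
    · rfl
  · intro h
    exact absurd (Finset.mem_range.2 (by omega)) h

end Recursion

/-! ### Coefficients for a prime power -/

section PrimePower

/-- In base `p` no carry occurs at the final zeros of `a`, so that
`v_p (a * (k choose a)) ≤ log_p k`. -/
theorem padicValNat_mul_choose_lt {p r a k : ℕ} [hp : Fact p.Prime] (ha : 0 < a) (hak : a ≤ k)
    (hk : k < p ^ r) : padicValNat p (a * k.choose a) < r := by
  have hs : p ^ padicValNat p a ∣ a := pow_padicValNat_dvd
  have hsr : padicValNat p a < r :=
    (Nat.pow_lt_pow_iff_right hp.out.one_lt).1 ((Nat.le_of_dvd ha hs).trans_lt (hak.trans_lt hk))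
  rw [padicValNat.mul ha.ne' (Nat.choose_pos hak).ne',
    padicValNat_choose hak (Nat.log_lt_of_lt_pow (by omega) hk)]
  have hsub : (Finset.Ico 1 r).filter (fun i => p ^ i ≤ a % p ^ i + (k - a) % p ^ i) ⊆
      Finset.Ico (padicValNat p a + 1) r := by
    intro i hi
    rw [Finset.mem_filter, Finset.mem_Ico] at hi
    rw [Finset.mem_Ico]
    refine ⟨?_, hi.1.2⟩
    by_contra hlt
    have hdvd : p ^ i ∣ a := (pow_dvd_pow p (by omega)).trans hs
    have h1 := Nat.mod_lt (k - a) (pow_pos hp.out.pos i)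
    have h2 := hi.2
    rw [Nat.mod_eq_zero_of_dvd hdvd] at h2
    omega
  have := Finset.card_le_card hsub
  rw [Nat.card_Ico] at this
  omega

theorem padicNorm_prime_pow_div_lt_one {p r n : ℕ} [hp : Fact p.Prime] (hn : n ≠ 0)
    (h : padicValNat p n < r) : padicNorm p ((p : ℚ) ^ r / n) < 1 := by
  have hp0 : (p : ℚ) ≠ 0 := Nat.cast_ne_zero.2 hp.out.ne_zero
  have hn0 : (n : ℚ) ≠ 0 := Nat.cast_ne_zero.2 hn
  rw [padicNorm.eq_zpow_of_nonzero (div_ne_zero (pow_ne_zero _ hp0) hn0),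
    padicValRat.div (pow_ne_zero _ hp0) hn0, padicValRat.pow, padicValRat.self hp.out.one_lt,
    padicValRat.of_nat]
  exact zpow_lt_one_of_neg₀ (by exact_mod_cast hp.out.one_lt) (by omega)

variable {K σ : Type*} [Field K] [Fintype σ] [DecidableEq σ]

/-- When `N = p ^ r`, the summand of the recursion that belongs to the trivial splitting dominates
`p`-adically: after division by `N * (|m| - 1)!` the coefficient is a rational `p`-adic unit. -/
theorem exists_padicNorm_eq_one [CharZero K] {p r : ℕ} [hp : Fact p.Prime] {e : K}
    (he : IsPrimitiveRoot e (p ^ r)) (w : σ → ℕ) {t : σ} {m : σ →₀ ℕ} (hm : m t = 0) (hm0 : m ≠ 0)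
    (hw : p ^ r ∣ Finsupp.weight w m) (hd : m.degree < p ^ r) :
    ∃ q : ℚ, padicNorm p q = 1 ∧
      labelledCoeff (p ^ r) e w t m = ((p ^ r * (m.degree - 1).factorial * q : ℚ) : K) := by
  induction hk : m.degree using Nat.strong_induction_on generalizing m with
  | _ k ih =>
  subst hk
  set S := (Finset.HasAntidiagonal.antidiagonal m).filter
    fun x => x.2 ≠ 0 ∧ p ^ r ∣ Finsupp.weight w x.2 with hS
  have hterm : ∀ x ∈ S, ∃ f : ℚ,
      (x.1 = 0 → padicNorm p f = 1) ∧ (x.1 ≠ 0 → padicNorm p f < 1) ∧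
      (-1) ^ (x.2.degree + 1) * ((p ^ r : ℕ) : K) * (∏ i, ((m i).choose (x.2 i) : K)) *
          (x.2.degree.factorial : K) * labelledCoeff (p ^ r) e w t x.1 =
        ((p ^ r * m.degree.factorial * f : ℚ) : K) := by
    intro x hx
    rw [hS, Finset.mem_filter, Finset.HasAntidiagonal.mem_antidiagonal] at hx
    obtain ⟨hx, hx2, hxw⟩ := hx
    have hb : 0 < x.2.degree := Nat.pos_of_ne_zero fun h => hx2 ((Finsupp.degree_eq_zero_iff _).1 h)
    have hab : x.1.degree + x.2.degree = m.degree := by rw [← hx, map_add]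
    by_cases h0 : x.1 = 0
    · have hxm : x.2 = m := by rw [← hx, h0, zero_add]
      refine ⟨(-1) ^ (m.degree + 1), fun _ => ?_, fun h => absurd h0 h, ?_⟩
      · rcases neg_one_pow_eq_or ℚ (m.degree + 1) with h | h <;> simp [h]
      · rw [h0, labelledCoeff_zero, hxm]
        simp only [Nat.choose_self, Nat.cast_one, Finset.prod_const_one]
        push_cast
        ring
    · have ha : 0 < x.1.degree :=
        Nat.pos_of_ne_zero fun h => h0 ((Finsupp.degree_eq_zero_iff _).1 h)
      have hxt : x.1 t = 0 := by
        have := DFunLike.congr_fun hx t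
        simp only [Finsupp.add_apply] at this; omega
      have hw1 : p ^ r ∣ Finsupp.weight w x.1 := by
        rw [← hx, map_add] at hw
        exact (Nat.dvd_add_left hxw).1 hw
      obtain ⟨q, hq1, hq⟩ := ih _ (by omega) hxt h0 hw1 (by omega) rfl
      -- With `a = |x.1|` and `k = |m|`, the second factor `N` comes with
      -- `|x.2|! * (a - 1)! / k! = 1 / (a * (k choose a))`.
      refine ⟨(-1) ^ (x.2.degree + 1) * (∏ i, (m i).choose (x.2 i) : ℕ) * q *
        ((p : ℚ) ^ r / (x.1.degree * m.degree.choose x.1.degree : ℕ)), fun h => absurd h h0,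
        fun _ => ?_, ?_⟩
      · have h1 : padicNorm p ((-1) ^ (x.2.degree + 1)) = 1 := by
          rcases neg_one_pow_eq_or ℚ (x.2.degree + 1) with h | h <;> simp [h]
        rw [padicNorm.mul, padicNorm.mul, padicNorm.mul, h1, hq1, one_mul, mul_one]
        refine (mul_le_of_le_one_left (padicNorm.nonneg _) (padicNorm.of_nat _)).trans_lt ?_
        exact padicNorm_prime_pow_div_lt_one
          (Nat.mul_pos ha (Nat.choose_pos (by omega))).ne'
          (padicValNat_mul_choose_lt ha (by omega) hd)
      · have h2 := Nat.choose_mul_factorial_mul_factorial (show x.1.degree ≤ m.degree by omega)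
        rw [show m.degree - x.1.degree = x.2.degree by omega,
          ← Nat.mul_factorial_pred ha.ne'] at h2
        have hc : ((x.1.degree * m.degree.choose x.1.degree : ℕ) : K) ≠ 0 :=
          Nat.cast_ne_zero.2 (Nat.mul_pos ha (Nat.choose_pos (by omega))).ne'
        rw [hq, ← h2]
        push_cast at hc ⊢
        obtain ⟨hc1, hc2⟩ := mul_ne_zero_iff.1 hc
        field_simp
  choose! f hf1 hf2 hf3 using hterm
  have hmem : ((0, m) : (σ →₀ ℕ) × (σ →₀ ℕ)) ∈ S := by
    rw [hS, Finset.mem_filter, Finset.HasAntidiagonal.mem_antidiagonal]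
    exact ⟨zero_add m, hm0, hw⟩
  refine ⟨∑ x ∈ S, f x, ?_, ?_⟩
  · rw [← Finset.add_sum_erase _ _ hmem]
    have h1 := hf1 _ hmem rfl
    have h2 : padicNorm p (∑ x ∈ S.erase (0, m), f x) < 1 := by
      refine padicNorm.sum_lt' (fun x hx => ?_) one_pos
      rw [Finset.mem_erase] at hx
      refine hf2 x hx.2 fun h => hx.1 ?_
      have h3 := hx.2
      rw [hS, Finset.mem_filter, Finset.HasAntidiagonal.mem_antidiagonal, h, zero_add] at h3
      exact Prod.ext h h3.1
    rw [padicNorm.add_eq_max_of_ne (by rw [h1]; exact h2.ne'), h1, max_eq_left h2.le]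
  · have hk : m.degree ≠ 0 := fun h => hm0 ((Finsupp.degree_eq_zero_iff _).1 h)
    have h := degree_mul_labelledCoeff he w hm
    rw [← hS, Finset.sum_congr rfl hf3, ← Rat.cast_sum, ← Finset.mul_sum,
      ← Nat.mul_factorial_pred hk] at h
    have hk' : (m.degree : K) ≠ 0 := Nat.cast_ne_zero.2 hk
    refine mul_left_cancel₀ hk' (h.trans ?_)
    push_cast
    ring

theorem coeff_truncEsymm_ne_zero [CharZero K] {p r : ℕ} [hp : Fact p.Prime] {e : K}
    (he : IsPrimitiveRoot e (p ^ r)) (w : σ → ℕ) {t : σ} {m : σ →₀ ℕ} (hm : m t = 0)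
    (hw : p ^ r ∣ Finsupp.weight w m) (hd : m.degree < p ^ r) :
    coeff m (truncEsymm (p ^ r) e w t m.degree) ≠ 0 := by
  intro h0
  have h1 : labelledCoeff (p ^ r) e w t m = 0 := by rw [labelledCoeff, h0, mul_zero]
  by_cases hm0 : m = 0
  · rw [hm0, labelledCoeff_zero] at h1
    exact one_ne_zero h1
  · obtain ⟨q, hq, hq'⟩ := exists_padicNorm_eq_one he w hm hm0 hw hd
    rw [h1] at hq'
    have hq0 : q ≠ 0 := by rintro rfl; simp at hq
    have hp0 : (p : ℚ) ≠ 0 := Nat.cast_ne_zero.2 hp.out.ne_zero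
    exact mul_ne_zero (mul_ne_zero (pow_ne_zero r hp0)
      (Nat.cast_ne_zero.2 (Nat.factorial_ne_zero _))) hq0 (Rat.cast_eq_zero.1 hq'.symm)

end PrimePower


/-! ### A vanishing coefficient when `N` is not a prime power -/

section Splitting

variable {K σ : Type*} [Field K] [CharZero K] [Fintype σ] [DecidableEq σ]

/-- For a monomial without nontrivial splittings the recursion has a single term. -/
theorem labelledCoeff_of_irreducible {N : ℕ} {e : K} (he : IsPrimitiveRoot e N) (w : σ → ℕ) {t : σ}
    {m : σ →₀ ℕ} (hm : m t = 0) (hm0 : m ≠ 0) (hw : N ∣ Finsupp.weight w m)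
    (hirr : ∀ v ≤ m, N ∣ Finsupp.weight w v → v = 0 ∨ v = m) :
    labelledCoeff N e w t m = (-1) ^ (m.degree + 1) * N * (m.degree - 1).factorial := by
  have hk : m.degree ≠ 0 := fun h => hm0 ((Finsupp.degree_eq_zero_iff _).1 h)
  have hk' : (m.degree : K) ≠ 0 := Nat.cast_ne_zero.2 hk
  have hS : (Finset.HasAntidiagonal.antidiagonal m).filter
      (fun x => x.2 ≠ 0 ∧ N ∣ Finsupp.weight w x.2) = {(0, m)} := by
    ext x
    rw [Finset.mem_filter, Finset.HasAntidiagonal.mem_antidiagonal, Finset.mem_singleton]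
    constructor
    · rintro ⟨hx, h0, hxw⟩
      have hxm : x.2 = m := (hirr _ (hx ▸ le_add_self) hxw).resolve_left h0
      rw [hxm] at hx
      exact Prod.ext (add_eq_right.1 hx) hxm
    · rintro rfl
      exact ⟨zero_add m, hm0, hw⟩
  refine mul_left_cancel₀ hk' ?_
  rw [degree_mul_labelledCoeff he w hm, hS, Finset.sum_singleton, labelledCoeff_zero,
    ← Nat.mul_factorial_pred hk]
  simp only [Nat.choose_self, Nat.cast_one, Finset.prod_const_one]
  push_cast
  ring

/-- If `P + Q` is the only nontrivial splitting of a monomial into monomials of weight divisible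
by `N`, then its coefficient is a difference of two explicit terms, which can cancel. -/
theorem labelledCoeff_eq_zero {N : ℕ} {e : K} (he : IsPrimitiveRoot e N) (w : σ → ℕ) {t : σ}
    {P Q : σ →₀ ℕ} (hP : P t = 0) (hQ : Q t = 0) (hPQ : ¬ P ≤ Q) (hQP : ¬ Q ≤ P)
    (hPw : N ∣ Finsupp.weight w P) (hQw : N ∣ Finsupp.weight w Q)
    (hsplit : ∀ v ≤ P + Q, N ∣ Finsupp.weight w v → v = 0 ∨ v = P ∨ v = Q ∨ v = P + Q)
    (hN : N * (∏ i, ((P + Q) i).choose (P i)) * (P.degree - 1).factorial *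
      (Q.degree - 1).factorial = (P.degree + Q.degree - 1).factorial) :
    labelledCoeff N e w t (P + Q) = 0 := by
  have hP0 : P ≠ 0 := by rintro rfl; exact hPQ zero_le
  have hQ0 : Q ≠ 0 := by rintro rfl; exact hQP zero_le
  have hne : P ≠ Q := by rintro rfl; exact hPQ le_rfl
  have hM : (P + Q) t = 0 := by simp [hP, hQ]
  have hdP : P.degree ≠ 0 := fun h => hP0 ((Finsupp.degree_eq_zero_iff _).1 h)
  have hdQ : Q.degree ≠ 0 := fun h => hQ0 ((Finsupp.degree_eq_zero_iff _).1 h)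
  have hAP := labelledCoeff_of_irreducible he w hP hP0 hPw (fun v hv hvw => by
    rcases hsplit v (hv.trans le_self_add) hvw with h | h | h | h
    · exact Or.inl h
    · exact Or.inr h
    · exact absurd (h ▸ hv) hQP
    · exact absurd (le_add_self.trans (h ▸ hv)) hQP)
  have hAQ := labelledCoeff_of_irreducible he w hQ hQ0 hQw (fun v hv hvw => by
    rcases hsplit v (hv.trans le_add_self) hvw with h | h | h | h
    · exact Or.inl h
    · exact absurd (h ▸ hv) hPQ
    · exact Or.inr h
    · exact absurd (le_self_add.trans (h ▸ hv)) hPQ)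
  have hS : (Finset.HasAntidiagonal.antidiagonal (P + Q)).filter
      (fun x => x.2 ≠ 0 ∧ N ∣ Finsupp.weight w x.2) = {(0, P + Q), (P, Q), (Q, P)} := by
    ext x
    rw [Finset.mem_filter, Finset.HasAntidiagonal.mem_antidiagonal]
    simp only [Finset.mem_insert, Finset.mem_singleton]
    constructor
    · rintro ⟨hx, h0, hxw⟩
      rcases hsplit _ (hx ▸ le_add_self) hxw with h | h | h | h
      · exact absurd h h0
      · rw [h, add_comm] at hx
        exact Or.inr (Or.inr (Prod.ext (add_left_cancel hx) h))
      · rw [h] at hx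
        exact Or.inr (Or.inl (Prod.ext (add_right_cancel hx) h))
      · rw [h] at hx
        exact Or.inl (Prod.ext (add_eq_right.1 hx) h)
    · rintro (rfl | rfl | rfl)
      · exact ⟨zero_add _, fun h => hP0 (add_eq_zero.1 h).1, by
          rw [map_add]; exact dvd_add hPw hQw⟩
      · exact ⟨rfl, hQ0, hQw⟩
      · exact ⟨add_comm _ _, hP0, hPw⟩
  have hk' : ((P + Q).degree : K) ≠ 0 := by
    rw [map_add]; exact Nat.cast_ne_zero.2 (by omega)
  have hsymm : ∏ i, (((P + Q) i).choose (Q i) : K) = ∏ i, (((P + Q) i).choose (P i) : K) := by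
    refine Finset.prod_congr rfl fun i _ => ?_
    rw [Finsupp.add_apply, Nat.choose_symm_add]
  refine (mul_eq_zero.1 ?_).resolve_left hk'
  rw [degree_mul_labelledCoeff he w hM, hS, Finset.sum_insert, Finset.sum_insert,
    Finset.sum_singleton, labelledCoeff_zero, hAP, hAQ, hsymm, map_add,
    ← Nat.mul_factorial_pred (show P.degree + Q.degree ≠ 0 by omega), ← hN,
    ← Nat.mul_factorial_pred hdP, ← Nat.mul_factorial_pred hdQ]
  · simp only [Nat.choose_self, Nat.cast_one, Finset.prod_const_one]
    push_cast
    ring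
  · rw [Finset.mem_singleton]
    exact fun h => hne (Prod.ext_iff.1 h).1
  · simp only [Finset.mem_insert, Finset.mem_singleton, Prod.ext_iff]
    rintro (h | h)
    · exact hP0 h.1.symm
    · exact hQ0 h.1.symm

end Splitting

/-- If `N ≥ 2` is not a power of a prime, the Chinese remainder theorem gives a nontrivial
idempotent modulo `N`; one of the two complementary idempotents is at most `N / 2`. -/
theorem exists_idempotent {N : ℕ} (hN : 2 ≤ N) (h : ¬ IsPrimePow N) :
    ∃ n, 2 ≤ n ∧ 2 * n ≤ N ∧ N ∣ n * (n - 1) := by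
  have hmf := Nat.minFac_prime (show N ≠ 1 by omega)
  obtain ⟨r, q, hq, hNq⟩ := Nat.exists_eq_pow_mul_and_not_dvd (show N ≠ 0 by omega) N.minFac
    hmf.ne_one
  set p := N.minFac
  have hr : r ≠ 0 := by
    rintro rfl
    rw [pow_zero, one_mul] at hNq
    exact hq (hNq ▸ N.minFac_dvd)
  have hq1 : q ≠ 1 := by
    rintro rfl
    rw [mul_one] at hNq
    exact h (hNq ▸ hmf.isPrimePow.pow hr)
  have hp1 : p ^ r ≠ 1 := (Nat.one_lt_pow hr hmf.one_lt).ne'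
  have hcop : Nat.Coprime (p ^ r) q := ((Nat.Prime.coprime_iff_not_dvd hmf).2 hq).pow_left r
  obtain ⟨⟨n, hn0, hn1⟩, hlt⟩ : ∃ x : {k // k ≡ 0 [MOD p ^ r] ∧ k ≡ 1 [MOD q]}, x.1 < N :=
    ⟨Nat.chineseRemainder hcop 0 1, hNq ▸ Nat.chineseRemainder_lt_mul hcop 0 1
      (pow_pos hmf.pos r).ne' (by rintro rfl; omega)⟩
  simp only at hlt
  have hd0 : p ^ r ∣ n := (Nat.modEq_zero_iff_dvd).1 hn0
  have hn2 : 2 ≤ n := by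
    by_contra hc
    interval_cases n
    · exact hq1 (Nat.dvd_one.1 ((Nat.modEq_zero_iff_dvd).1 hn1.symm))
    · exact hp1 (Nat.dvd_one.1 hd0)
  have hd1 : q ∣ n - 1 := (Nat.modEq_iff_dvd' (by omega)).1 hn1.symm
  -- `2 * n' = N + 1` is impossible, since then `4 * n' * (n' - 1) = N ^ 2 - 1`.
  have key : ∀ n', 2 ≤ n' → 2 * n' ≤ N + 1 → N ∣ n' * (n' - 1) → 2 * n' ≤ N := by
    intro n' h2 hle hdvd
    by_contra hc
    obtain ⟨b, rfl⟩ : ∃ b, n' = b + 1 := ⟨n' - 1, by omega⟩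
    rw [show N = 2 * b + 1 by omega, Nat.add_sub_cancel] at hdvd
    have h1 : (2 * b + 1) ∣ 1 := by
      have h3 : 4 * ((b + 1) * b) + 1 = (2 * b + 1) * (2 * b + 1) := by ring
      exact (Nat.dvd_add_right (hdvd.mul_left 4)).1 (h3 ▸ dvd_mul_right _ _)
    have := Nat.dvd_one.1 h1
    omega
  have hpN : p ^ r ∣ N := hNq ▸ dvd_mul_right _ _
  have hqN : q ∣ N := hNq ▸ dvd_mul_left _ _
  rcases le_total (2 * n) (N + 1) with hle | hle
  · have hdvd : N ∣ n * (n - 1) := by rw [hNq]; exact mul_dvd_mul hd0 hd1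
    exact ⟨n, hn2, key n hn2 hle hdvd, hdvd⟩
  · have hdvd : N ∣ (N - (n - 1)) * ((N - (n - 1)) - 1) := by
      rw [show N - (n - 1) - 1 = N - n by omega, mul_comm]
      conv_lhs => rw [hNq]
      exact mul_dvd_mul (Nat.dvd_sub hpN hd0) (Nat.dvd_sub hqN hd1)
    exact ⟨_, by omega, key _ (by omega) (by omega) hdvd, hdvd⟩

/-- The numerical conditions under which the coefficient of `x_1 ^ (a + c) * x_{N-a} * x_k * x_l`
vanishes. They are met with `n = a + c + 2` a nontrivial idempotent modulo `N` with `2 * n ≤ N` and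
`c + 1 = n * (n - 1) / N`; then `N - c` is split into nearly equal parts `k` and `l`, so that `k` and
`l` are too small for other splittings to occur. -/
theorem exists_vanishing_parameters {N : ℕ} (hN : 2 ≤ N) (h : ¬ IsPrimePow N) :
    ∃ a c k l : ℕ, 1 ≤ a ∧ N * (c + 1) = (a + c + 2) * (a + c + 1) ∧ a + c + 2 < N ∧
      k + l + c = N ∧ 2 ≤ k ∧ k < l ∧ l + a + c < N := by
  obtain ⟨n, h2, hle, v, hv⟩ := exists_idempotent hN h
  have hv0 : v ≠ 0 := by
    rintro rfl
    rcases Nat.mul_eq_zero.1 hv with h | h <;> omega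
  have hvn : v + 2 ≤ n := by
    by_contra hc
    have h1 : N * (n - 1) ≤ n * (n - 1) := hv ▸ Nat.mul_le_mul_left N (by omega)
    have := Nat.le_of_mul_le_mul_right h1 (by omega)
    omega
  refine ⟨n - 1 - v, v - 1, (N - (v - 1) - 1) / 2, N - (v - 1) - (N - (v - 1) - 1) / 2,
    by omega, ?_, by omega, by omega, by omega, by omega, by omega⟩
  rw [show v - 1 + 1 = v by omega, ← hv, show n - 1 - v + (v - 1) + 2 = n by omega,
    show n - 1 - v + (v - 1) + 1 = n - 1 by omega]

/-- The factors of weight divisible by `N` of `x_1 ^ (a + c) * x_{N-a} * x_k * x_l`, with exponents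
`x, y, z, u`. -/
theorem splitting_cases {N a c k l x y z u : ℕ} (ha : 1 ≤ a) (hkl : k + l + c = N) (hk : 2 ≤ k)
    (hkl' : k < l) (hl : l + a + c < N) (hx : x ≤ a + c) (hy : y ≤ 1 + 0) (hz : z ≤ 0 + 1)
    (hu : u ≤ 0 + 1) (hdvd : N ∣ x + y * (N - a) + z * k + u * l)
    (hle : x + y * (N - a) + z * k + u * l ≤ 2 * N) :
    (x = 0 ∧ y = 0 ∧ z = 0 ∧ u = 0) ∨ (x = a ∧ y = 1 ∧ z = 0 ∧ u = 0) ∨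
      (x = c ∧ y = 0 ∧ z = 1 ∧ u = 1) ∨ (x = a + c ∧ y = 1 ∧ z = 1 ∧ u = 1) := by
  -- The whole monomial has weight `2 * N`, so only the weights `0`, `N` and `2 * N` can occur.
  obtain ⟨b, hb⟩ := hdvd
  have hb2 : b ≤ 2 := by
    by_contra hc
    have : N * 3 ≤ N * b := Nat.mul_le_mul_left N (by omega)
    omega
  interval_cases b <;> interval_cases y <;> interval_cases z <;> interval_cases u <;> omega

/-- If `N` is not a power of a prime, some monomial without `x_0`, of degree less than `N` and weight
divisible by `N`, has coefficient zero: it is `x_1 ^ (a + c) * x_{N-a} * x_k * x_l`, whose only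
nontrivial splitting is `x_1 ^ a * x_{N-a}` times `x_1 ^ c * x_k * x_l`. -/
theorem exists_coeff_truncEsymm_eq_zero {K : Type*} [Field K] [CharZero K] {N : ℕ} (hN : 2 ≤ N)
    (h : ¬ IsPrimePow N) {e : K} (he : IsPrimitiveRoot e N) (t : Fin N) (ht : (t : ℕ) = 0) :
    ∃ m : Fin N →₀ ℕ, m t = 0 ∧ m.degree < N ∧ N ∣ Finsupp.weight (fun i : Fin N => (i : ℕ)) m ∧
      coeff m (truncEsymm N e (fun i : Fin N => (i : ℕ)) t m.degree) = 0 := by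
  obtain ⟨a, c, k, l, ha, hac, hacN, hkl, hk2, hkl2, hl⟩ := exists_vanishing_parameters hN h
  set w : Fin N → ℕ := fun i => (i : ℕ) with hw
  obtain ⟨i1, hi1⟩ : ∃ i : Fin N, (i : ℕ) = 1 := ⟨⟨1, by omega⟩, rfl⟩
  obtain ⟨ij, hij⟩ : ∃ i : Fin N, (i : ℕ) = N - a := ⟨⟨N - a, by omega⟩, rfl⟩
  obtain ⟨ik, hik⟩ : ∃ i : Fin N, (i : ℕ) = k := ⟨⟨k, by omega⟩, rfl⟩
  obtain ⟨il, hil⟩ : ∃ i : Fin N, (i : ℕ) = l := ⟨⟨l, by omega⟩, rfl⟩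
  have n1j : i1 ≠ ij := fun hh => by rw [Fin.ext_iff] at hh; omega
  have n1k : i1 ≠ ik := fun hh => by rw [Fin.ext_iff] at hh; omega
  have n1l : i1 ≠ il := fun hh => by rw [Fin.ext_iff] at hh; omega
  have njk : ij ≠ ik := fun hh => by rw [Fin.ext_iff] at hh; omega
  have njl : ij ≠ il := fun hh => by rw [Fin.ext_iff] at hh; omega
  have nkl : ik ≠ il := fun hh => by rw [Fin.ext_iff] at hh; omega
  have nt1 : t ≠ i1 := fun hh => by rw [Fin.ext_iff] at hh; omega
  have ntj : t ≠ ij := fun hh => by rw [Fin.ext_iff] at hh; omega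
  have ntk : t ≠ ik := fun hh => by rw [Fin.ext_iff] at hh; omega
  have ntl : t ≠ il := fun hh => by rw [Fin.ext_iff] at hh; omega
  set P : Fin N →₀ ℕ := Finsupp.single i1 a + Finsupp.single ij 1 with hP
  set Q : Fin N →₀ ℕ := Finsupp.single i1 c + Finsupp.single ik 1 + Finsupp.single il 1 with hQ
  have P1 : P i1 = a := by simp [hP, n1j]
  have Pj : P ij = 1 := by simp [hP, n1j]
  have Pk : P ik = 0 := by simp [hP, n1k, njk]
  have Pl : P il = 0 := by simp [hP, n1l, njl]
  have Q1 : Q i1 = c := by simp [hQ, n1k, n1l]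
  have Qj : Q ij = 0 := by simp [hQ, n1j, njk, njl]
  have Qk : Q ik = 1 := by simp [hQ, n1k, nkl]
  have Ql : Q il = 1 := by simp [hQ, n1l, nkl]
  have hother : ∀ i, i ≠ i1 → i ≠ ij → i ≠ ik → i ≠ il → P i = 0 ∧ Q i = 0 := by
    intro i h1 h2 h3 h4
    simp [hP, hQ, h1.symm, h2.symm, h3.symm, h4.symm]
  have hdP : P.degree = a + 1 := by simp [hP]
  have hdQ : Q.degree = c + 2 := by simp [hQ]
  have hPw : Finsupp.weight w P = N := by simp [hP, hw, hi1, hij, Finsupp.weight_single]; omega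
  have hQw : Finsupp.weight w Q = N := by
    simp [hQ, hw, hi1, hik, hil, Finsupp.weight_single]; omega
  obtain ⟨htP, htQ⟩ := hother t nt1 ntj ntk ntl
  refine ⟨P + Q, by simp [htP, htQ], by rw [map_add]; omega, by simp [hPw, hQw], ?_⟩
  have key := labelledCoeff_eq_zero he w htP htQ (fun hh => by have := hh ij; omega)
    (fun hh => by have := hh ik; omega) (by rw [hPw]) (by rw [hQw]) ?_ ?_
  · refine (mul_eq_zero.1 key).resolve_left (Finset.prod_ne_zero_iff.2 fun i _ => ?_)
    exact Nat.cast_ne_zero.2 (Nat.factorial_ne_zero _)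
  · intro v hv hvw
    have hv1 := hv i1
    have hvj := hv ij
    have hvk := hv ik
    have hvl := hv il
    rw [Finsupp.add_apply] at hv1 hvj hvk hvl
    have hv0 : ∀ i, i ≠ i1 → i ≠ ij → i ≠ ik → i ≠ il → v i = 0 := by
      intro i h1 h2 h3 h4
      have h5 := hv i
      obtain ⟨h6, h7⟩ := hother i h1 h2 h3 h4
      rw [Finsupp.add_apply] at h5
      omega
    have hext : ∀ u : Fin N →₀ ℕ, (∀ i, i ≠ i1 → i ≠ ij → i ≠ ik → i ≠ il → u i = 0) →
        v i1 = u i1 → v ij = u ij → v ik = u ik → v il = u il → v = u := by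
      intro u hu e1 e2 e3 e4
      ext i
      by_cases h1 : i = i1
      · rw [h1, e1]
      by_cases h2 : i = ij
      · rw [h2, e2]
      by_cases h3 : i = ik
      · rw [h3, e3]
      by_cases h4 : i = il
      · rw [h4, e4]
      rw [hv0 i h1 h2 h3 h4, hu i h1 h2 h3 h4]
    have hvexp : v = Finsupp.single i1 (v i1) + Finsupp.single ij (v ij) +
        Finsupp.single ik (v ik) + Finsupp.single il (v il) := by
      apply hext
      · intro i h1 h2 h3 h4
        simp [h1.symm, h2.symm, h3.symm, h4.symm]
      · simp [n1j, n1k, n1l]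
      · simp [n1j, njk, njl]
      · simp [n1k, njk, nkl]
      · simp [n1l, njl, nkl]
    have hweight : Finsupp.weight w v = v i1 + v ij * (N - a) + v ik * k + v il * l := by
      conv_lhs => rw [hvexp]
      simp [hw, hi1, hij, hik, hil, Finsupp.weight_single]
    have hle : Finsupp.weight w v ≤ 2 * N := by
      obtain ⟨u, hu⟩ := le_iff_exists_add.1 hv
      have h1 : Finsupp.weight w (P + Q) = Finsupp.weight w v + Finsupp.weight w u := by
        rw [hu, map_add]
      rw [map_add _ P Q, hPw, hQw] at h1
      omega
    rw [hweight] at hvw hle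
    rw [P1, Q1] at hv1
    rw [Pj, Qj] at hvj
    rw [Pk, Qk] at hvk
    rw [Pl, Ql] at hvl
    have hcase := splitting_cases ha hkl hk2 hkl2 hl hv1 hvj hvk hvl hvw hle
    rcases hcase with ⟨e1, e2, e3, e4⟩ | ⟨e1, e2, e3, e4⟩ | ⟨e1, e2, e3, e4⟩ | ⟨e1, e2, e3, e4⟩
    · exact Or.inl (hext 0 (fun _ _ _ _ _ => rfl) e1 e2 e3 e4)
    · exact Or.inr (Or.inl (hext P (fun i h1 h2 h3 h4 => (hother i h1 h2 h3 h4).1)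
        (by omega) (by omega) (by omega) (by omega)))
    · exact Or.inr (Or.inr (Or.inl (hext Q (fun i h1 h2 h3 h4 => (hother i h1 h2 h3 h4).2)
        (by omega) (by omega) (by omega) (by omega))))
    · refine Or.inr (Or.inr (Or.inr (hext (P + Q) (fun i h1 h2 h3 h4 => ?_) ?_ ?_ ?_ ?_))) <;>
        rw [Finsupp.add_apply]
      · obtain ⟨h5, h6⟩ := hother i h1 h2 h3 h4
        omega
      all_goals omega
  · have hprod : ∏ i, ((P + Q) i).choose (P i) = (a + c).choose a := by
      rw [Finset.prod_eq_single i1]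
      · rw [Finsupp.add_apply, P1, Q1]
      · intro i _ h1
        by_cases h2 : i = ij
        · rw [h2, Finsupp.add_apply, Pj, Qj, Nat.choose_self]
        · have : P i = 0 := by simp [hP, h1.symm, Ne.symm h2]
          rw [this, Nat.choose_zero_right]
      · exact fun hh => absurd (Finset.mem_univ i1) hh
    have hch := Nat.add_choose_mul_factorial_mul_factorial a c
    rw [← Nat.choose_symm_add] at hch
    rw [hprod, hdP, hdQ, Nat.add_sub_cancel, show c + 2 - 1 = c + 1 by omega,
      show a + 1 + (c + 2) - 1 = (a + c + 1) + 1 by omega, Nat.factorial_succ (a + c + 1),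
      Nat.factorial_succ (a + c), Nat.factorial_succ c, ← hch]
    calc N * (a + c).choose a * a.factorial * ((c + 1) * c.factorial)
        = (N * (c + 1)) * ((a + c).choose a * a.factorial * c.factorial) := by ring
      _ = _ := by rw [hac]; ring


/-! ### Ideals generated by monomials of one degree -/

section MonomialIdeals

variable {K : Type*} [Field K] {n : ℕ}

theorem coeff_aeval_C_mul_X (a : Fin n → K) (F : MvPolynomial (Fin n) K) (m : Fin n →₀ ℕ) :
    coeff m (aeval (fun i => C (a i) * X i : Fin n → MvPolynomial (Fin n) K) F) =
      (∏ i, a i ^ m i) * coeff m F := by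
  induction F using MvPolynomial.induction_on' with
  | monomial u c =>
    have h : aeval (fun i => C (a i) * X i : Fin n → MvPolynomial (Fin n) K) (monomial u c) =
        monomial u ((∏ i, a i ^ u i) * c) := by
      rw [aeval_monomial, Finsupp.prod_fintype _ _ (by simp), monomial_eq (s := u),
        Finsupp.prod_fintype _ _ (by simp), C_mul, map_prod]
      simp_rw [mul_pow, Finset.prod_mul_distrib, map_pow]
      rw [algebraMap_eq]
      ring
    rw [h, coeff_monomial, coeff_monomial]
    split_ifs with hu
    · rw [hu]
    · rw [mul_zero]
  | add p q hp hq => rw [map_add, coeff_add, coeff_add, hp, hq, mul_add]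

theorem coeff_diagonalAction (e : K) (α : Fin n → ℕ) (F : MvPolynomial (Fin n) K)
    (m : Fin n →₀ ℕ) :
    coeff m (diagonalAction e α F) = e ^ Finsupp.weight α m * coeff m F := by
  rw [diagonalAction, coeff_aeval_C_mul_X, Finsupp.weight_apply, Finsupp.sum_fintype _ _ (by simp),
    ← Finset.prod_pow_eq_pow_sum]
  congr 1
  refine Finset.prod_congr rfl fun i _ => ?_
  rw [← pow_mul, smul_eq_mul, mul_comm]

theorem mem_monomialIdeal {S : Set (Fin n →₀ ℕ)} {F : MvPolynomial (Fin n) K} :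
    F ∈ monomialIdeal K S ↔ ∀ m ∈ F.support, ∃ s ∈ S, s ≤ m :=
  mem_ideal_span_monomial_image

theorem eq_of_le_of_degree_eq {s m : Fin n →₀ ℕ} (h : s ≤ m) (hd : s.degree = m.degree) :
    s = m := by
  obtain ⟨u, rfl⟩ := le_iff_exists_add.1 h
  rw [map_add, left_eq_add, Finsupp.degree_eq_zero_iff] at hd
  rw [hd, add_zero]

theorem degree_le_degree {s m : Fin n →₀ ℕ} (h : s ≤ m) : s.degree ≤ m.degree := by
  obtain ⟨u, rfl⟩ := le_iff_exists_add.1 h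
  rw [map_add]
  exact Nat.le_add_right _ _

theorem mem_monomialIdeal_of_isHomogeneous {d : ℕ} {S : Set (Fin n →₀ ℕ)}
    (hS : ∀ s ∈ S, s.degree = d) {F : MvPolynomial (Fin n) K} (hF : F.IsHomogeneous d) :
    F ∈ monomialIdeal K S ↔ ∀ m, coeff m F ≠ 0 → m ∈ S := by
  rw [mem_monomialIdeal]
  refine forall_congr' fun m => ?_
  rw [mem_support_iff]
  refine imp_congr_right fun hm => ⟨?_, fun h => ⟨m, h, le_rfl⟩⟩
  rintro ⟨s, hs, hsm⟩
  have hd : m.degree = d := by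
    by_contra hne
    exact hm (hF.coeff_eq_zero hne)
  rwa [← eq_of_le_of_degree_eq hsm ((hS s hs).trans hd.symm)]

theorem notMem_monomialIdeal_of_isHomogeneous {d j : ℕ} {S : Set (Fin n →₀ ℕ)}
    (hS : ∀ s ∈ S, s.degree = d) (hj : j < d) {F : MvPolynomial (Fin n) K}
    (hF : F.IsHomogeneous j) (hF0 : F ≠ 0) : F ∉ monomialIdeal K S := by
  obtain ⟨m, hm⟩ := ne_zero_iff.1 hF0
  intro h
  obtain ⟨s, hs, hsm⟩ := mem_monomialIdeal.1 h m (mem_support_iff.2 hm)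
  have h1 := degree_le_degree hsm
  have hd : m.degree = j := by
    by_contra hne
    exact hm (hF.coeff_eq_zero hne)
  rw [hS s hs, hd] at h1
  omega

theorem minimalMonomialGenerators_monomialIdeal {d : ℕ} {S : Set (Fin n →₀ ℕ)}
    (hS : ∀ s ∈ S, s.degree = d) : minimalMonomialGenerators (monomialIdeal K S) = S := by
  have hmem : ∀ m : Fin n →₀ ℕ, monomial m (1 : K) ∈ monomialIdeal K S ↔ ∃ s ∈ S, s ≤ m := by
    intro m
    rw [mem_monomialIdeal]
    classical simp [support_monomial]
  ext m
  rw [minimalMonomialGenerators, Set.mem_ofPred_eq]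
  simp_rw [hmem]
  constructor
  · rintro ⟨⟨s, hs, hsm⟩, hmin⟩
    rwa [← hsm.antisymm (hmin ⟨s, hs, le_rfl⟩ hsm)]
  · intro hm
    refine ⟨⟨m, hm, le_rfl⟩, ?_⟩
    rintro m' ⟨s, hs, hsm⟩ hle
    rw [← eq_of_le_of_degree_eq (hsm.trans hle) ((hS s hs).trans (hS m hm).symm)]
    exact hsm

/-- A monomial ideal containing a power of every variable is artinian. -/
theorem isArtinianRing_quotient_monomialIdeal {d : ℕ} (hd : d ≠ 0) {S : Set (Fin n →₀ ℕ)}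
    (hS : ∀ i, Finsupp.single i d ∈ S) :
    IsArtinianRing (MvPolynomial (Fin n) K ⧸ monomialIdeal K S) := by
  set J := monomialIdeal K S
  have hint : ∀ x ∈ Set.range (fun i => Ideal.Quotient.mkₐ K J (X i)), IsIntegral K x := by
    rintro _ ⟨i, rfl⟩
    refine IsIntegral.of_pow (Nat.pos_of_ne_zero hd) ?_
    have h0 : Ideal.Quotient.mkₐ K J (X i) ^ d = 0 := by
      rw [← map_pow, Ideal.Quotient.mkₐ_eq_mk, Ideal.Quotient.eq_zero_iff_mem, X_pow_eq_monomial]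
      exact Ideal.subset_span ⟨_, hS i, rfl⟩
    rw [h0]
    exact isIntegral_zero
  have hfin := Algebra.finite_adjoin_of_finite_of_isIntegral (Set.finite_range _) hint
  have htop : Algebra.adjoin K (Set.range (fun i => Ideal.Quotient.mkₐ K J (X i))) = ⊤ := by
    rw [Set.range_comp' (Ideal.Quotient.mkₐ K J) X, ← AlgHom.map_adjoin, adjoin_range_X,
      Algebra.map_top, AlgHom.range_eq_top]
    exact Ideal.Quotient.mkₐ_surjective K J
  rw [htop] at hfin
  have : Module.Finite K (MvPolynomial (Fin n) K ⧸ J) :=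
    Module.Finite.equiv (Subalgebra.topEquiv (R := K)
      (A := MvPolynomial (Fin n) K ⧸ J)).toLinearEquiv
  exact IsArtinianRing.of_finite K _

theorem mem_finsuppAntidiag_univ {d : ℕ} {m : Fin n →₀ ℕ} :
    m ∈ (Finset.univ : Finset (Fin n)).finsuppAntidiag d ↔ m.degree = d := by
  rw [Finset.mem_finsuppAntidiag, Finsupp.degree_eq_sum]
  simp

theorem card_finsuppAntidiag_univ (d : ℕ) :
    ((Finset.univ : Finset (Fin n)).finsuppAntidiag d).card = (n + d - 1).choose d := by
  rw [Finset.card_finsuppAntidiag_nat_eq_choose, Finset.card_univ, Fintype.card_fin]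

open Classical in
theorem homogeneousSubmodule_le_span (d : ℕ) :
    homogeneousSubmodule (Fin n) K d ≤ Submodule.span K
      (((Finset.univ : Finset (Fin n)).finsuppAntidiag d).image
        fun m => monomial m (1 : K) : Finset (MvPolynomial (Fin n) K)) := by
  intro F hF
  rw [F.as_sum]
  refine Submodule.sum_mem _ fun m hm => ?_
  have h1 : monomial m (coeff m F) = coeff m F • monomial m (1 : K) := by
    rw [smul_monomial, smul_eq_mul, mul_one]
  rw [h1]
  refine Submodule.smul_mem _ _ (Submodule.subset_span ?_)
  rw [Finset.coe_image]
  refine ⟨m, Finset.mem_coe.2 (mem_finsuppAntidiag_univ.2 ?_), rfl⟩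
  by_contra hne
  exact mem_support_iff.1 hm (IsHomogeneous.coeff_eq_zero hF hne)

instance finite_homogeneousSubmodule (d : ℕ) :
    Module.Finite K (homogeneousSubmodule (Fin n) K d) :=
  Submodule.finiteDimensional_of_le (homogeneousSubmodule_le_span d)

instance finite_gradedPiece (J : Ideal (MvPolynomial (Fin n) K)) (d : ℕ) :
    Module.Finite K (gradedPiece J d) := by
  rw [gradedPiece]; infer_instance

theorem finrank_gradedPiece_le (J : Ideal (MvPolynomial (Fin n) K)) (d : ℕ) :
    Module.finrank K (gradedPiece J d) ≤
      ((Finset.univ : Finset (Fin n)).finsuppAntidiag d).card := by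
  classical
  refine (Submodule.finrank_map_le _ _).trans ?_
  refine (Submodule.finrank_mono (homogeneousSubmodule_le_span d)).trans ?_
  exact (finrank_span_finset_le_card _).trans Finset.card_image_le

/-- The monomials of degree `d` that are not among the generators stay linearly independent. -/
theorem card_sub_card_le_finrank_gradedPiece {d : ℕ} {S : Finset (Fin n →₀ ℕ)}
    (hS : ∀ s ∈ S, s.degree = d) :
    ((Finset.univ : Finset (Fin n)).finsuppAntidiag d).card - S.card ≤
      Module.finrank K (gradedPiece (monomialIdeal K (S : Set (Fin n →₀ ℕ))) d) := by
  classical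
  set J := monomialIdeal K (S : Set (Fin n →₀ ℕ))
  set T := (Finset.univ : Finset (Fin n)).finsuppAntidiag d \ S with hT
  have hTd : ∀ m ∈ T, m.degree = d := fun m hm =>
    mem_finsuppAntidiag_univ.1 (Finset.mem_sdiff.1 hm).1
  let v : T → gradedPiece J d := fun m => ⟨Ideal.Quotient.mkₐ K J (monomial m.1 1), monomial m.1 1,
    isHomogeneous_monomial _ (hTd _ m.2), rfl⟩
  have hv : LinearIndependent K v := by
    rw [Fintype.linearIndependent_iff]
    intro g hg m
    have h1 : Ideal.Quotient.mkₐ K J (∑ m : T, monomial m.1 (g m)) = 0 := by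
      have h2 := congrArg Subtype.val hg
      rw [AddSubmonoidClass.coe_finsetSum] at h2
      rw [map_sum]
      refine Eq.trans ?_ h2
      refine Finset.sum_congr rfl fun m _ => ?_
      simp only [v, SetLike.val_smul]
      rw [← map_smul, smul_monomial, smul_eq_mul, mul_one]
    rw [Ideal.Quotient.mkₐ_eq_mk, Ideal.Quotient.eq_zero_iff_mem,
      mem_monomialIdeal_of_isHomogeneous (fun s hs => hS s hs)
        (IsHomogeneous.sum _ _ _ fun m _ => isHomogeneous_monomial _ (hTd _ m.2))] at h1
    have h3 : coeff m.1 (∑ m : T, monomial m.1 (g m)) = g m := by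
      rw [coeff_sum, Finset.sum_eq_single m]
      · rw [coeff_monomial, if_pos rfl]
      · intro b _ hb
        rw [coeff_monomial, if_neg fun h => hb (Subtype.ext h)]
      · exact fun h => absurd (Finset.mem_univ m) h
    by_contra hne
    exact (Finset.mem_sdiff.1 m.2).2 (h1 m.1 (h3 ▸ hne))
  have h := hv.fintype_card_le_finrank
  rw [Fintype.card_coe] at h
  exact (Finset.le_card_sdiff _ _).trans h

/-- If `J` is generated by at most `binom (n + d - 2) (n - 2)` monomials of degree `d`, the graded
piece of degree `d` is at least as large as the previous one, so that multiplication maps between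
them that are not injective are not surjective either. -/
theorem injective_of_surjective_mulMap (hn : 2 ≤ n) {d : ℕ} (hd : 1 ≤ d)
    {S : Finset (Fin n →₀ ℕ)} (hS : ∀ s ∈ S, s.degree = d)
    (hcard : S.card ≤ (n + d - 2).choose (n - 2))
    (L : gradedPiece (monomialIdeal K (S : Set (Fin n →₀ ℕ))) 1)
    (h : Function.Surjective (mulMap _ L (d - 1))) :
    Function.Injective (mulMap _ L (d - 1)) := by
  have h1 := finrank_gradedPiece_le (monomialIdeal K (S : Set (Fin n →₀ ℕ))) (d - 1)
  have h2 := card_sub_card_le_finrank_gradedPiece (K := K) hS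
  rw [card_finsuppAntidiag_univ] at h1 h2
  have h3 : (n + d - 1).choose d = (n + (d - 1) - 1).choose (d - 1) +
      (n + d - 2).choose (n - 2) := by
    obtain ⟨d, rfl⟩ : ∃ d', d = d' + 1 := ⟨d - 1, by omega⟩
    obtain ⟨n, rfl⟩ : ∃ n', n = n' + 2 := ⟨n - 2, by omega⟩
    rw [show n + 2 + (d + 1) - 1 = (n + d + 1) + 1 by omega, Nat.choose_succ_succ,
      show n + 2 + (d + 1 - 1) - 1 = n + d + 1 by omega,
      show n + 2 + (d + 1) - 2 = n + d + 1 by omega, Nat.add_sub_cancel, Nat.add_sub_cancel,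
      ← Nat.choose_symm_of_eq_add (show n + d + 1 = (d + 1) + n by omega)]
  have h4 := LinearMap.finrank_le_finrank_of_surjective h
  rw [← Nat.sub_add_cancel hd] at h2
  refine (LinearMap.injective_iff_surjective_of_finrank_eq_finrank (le_antisymm ?_ h4)).2 h
  rw [Nat.sub_add_cancel hd] at h2
  have h5 : Module.finrank K (gradedPiece (monomialIdeal K (S : Set (Fin n →₀ ℕ))) d) =
    Module.finrank K (gradedPiece (monomialIdeal K (S : Set (Fin n →₀ ℕ))) (d - 1 + 1)) := by
    rw [Nat.sub_add_cancel hd]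
  omega

end MonomialIdeals

/-! ### The circulant determinant and the invariant monomials -/

section Circulant

variable {R : Type*} [CommRing R]

/-- The determinant of the generic circulant matrix in its factored form: the product over
`0 ≤ r < N` of the linear forms `∑ j, e ^ (r * j) * x_j`. -/
noncomputable def circulantForm (N : ℕ) (e : R) : MvPolynomial (Fin N) R :=
  ∏ r : Fin N, linForm e (fun j : Fin N => (j : ℕ)) r

theorem map_circulantForm {R' : Type*} [CommRing R'] (N : ℕ) (e : R) (φ : R →+* R') :
    map φ (circulantForm N e) = circulantForm N (φ e) := by
  simp [circulantForm, linForm]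

theorem coeff_circulantForm_eq_aeval (N : ℕ) (x : R) (m : Fin N →₀ ℕ) :
    coeff m (circulantForm N x) =
      Polynomial.aeval x (coeff m (circulantForm N (Polynomial.X : Polynomial ℤ))) := by
  have h := congrArg (coeff m) (map_circulantForm N (Polynomial.X : Polynomial ℤ)
    (Polynomial.aeval x : Polynomial ℤ →ₐ[ℤ] R).toRingHom)
  rw [coeff_map] at h
  simpa using h.symm

/-- The coefficients of the circulant determinant are integral polynomials in the primitive root
of unity, so that one which vanishes over a field of characteristic zero vanishes over every
field. -/
theorem coeff_circulantForm_eq_zero_of_charZero {N : ℕ} (hN : 0 < N) {F K : Type*} [Field F]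
    [CharZero F] [Field K] {ζ : F} (hζ : IsPrimitiveRoot ζ N) {e : K} (he : IsPrimitiveRoot e N)
    {m : Fin N →₀ ℕ} (h : coeff m (circulantForm N ζ) = 0) : coeff m (circulantForm N e) = 0 := by
  set f : Polynomial ℤ := coeff m (circulantForm N (Polynomial.X : Polynomial ℤ)) with hf
  have h1 : Polynomial.aeval ζ f = 0 := by rw [hf, ← coeff_circulantForm_eq_aeval, h]
  have hdvd : Polynomial.cyclotomic N ℤ ∣ f := by
    rw [Polynomial.cyclotomic_eq_minpoly hζ hN]
    exact minpoly.isIntegrallyClosed_dvd (hζ.isIntegral hN) h1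
  obtain ⟨g, hg⟩ := hdvd
  have hroot : Polynomial.aeval e (Polynomial.cyclotomic N ℤ) = 0 := by
    have : NeZero N := ⟨hN.ne'⟩
    have := he.neZero'
    rw [Polynomial.aeval_def, Polynomial.eval₂_eq_eval_map, Polynomial.map_cyclotomic]
    exact he.isRoot_cyclotomic hN
  rw [coeff_circulantForm_eq_aeval, ← hf, hg, map_mul, hroot, zero_mul]

variable {K : Type*} [Field K] {N : ℕ}

theorem coeff_linForm (e : R) (r : ℕ) (i : Fin N) :
    coeff (Finsupp.single i 1) (linForm e (fun j : Fin N => (j : ℕ)) r) = e ^ (r * i) := by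
  rw [linForm, coeff_sum, Finset.sum_eq_single i]
  · rw [coeff_C_mul, coeff_X, if_pos rfl, mul_one]
  · intro j _ hj
    rw [coeff_C_mul, coeff_X, if_neg, mul_zero]
    intro h
    exact hj (Finsupp.single_left_injective one_ne_zero h)
  · exact fun h => absurd (Finset.mem_univ i) h

theorem linForm_isHomogeneous (e : R) (r : ℕ) :
    (linForm e (fun j : Fin N => (j : ℕ)) r).IsHomogeneous 1 :=
  IsHomogeneous.sum _ _ _ fun j _ => (isHomogeneous_X R j).C_mul _

theorem circulantForm_isHomogeneous (e : R) : (circulantForm N e).IsHomogeneous N := by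
  have h := IsHomogeneous.prod Finset.univ
    (fun r : Fin N => linForm e (fun j : Fin N => (j : ℕ)) r) (fun _ => 1)
    fun r _ => linForm_isHomogeneous e r
  rwa [Finset.sum_const, Finset.card_univ, Fintype.card_fin, smul_eq_mul, mul_one] at h

theorem linForm_ne_zero (hN : 0 < N) (e : K) (r : ℕ) :
    linForm e (fun j : Fin N => (j : ℕ)) r ≠ 0 := by
  intro h
  have h1 := coeff_linForm e r (⟨0, hN⟩ : Fin N)
  rw [h, coeff_zero] at h1
  simp at h1

theorem linForm_irreducible (hN : 0 < N) (e : K) (r : ℕ) :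
    Irreducible (linForm e (fun j : Fin N => (j : ℕ)) r) := by
  refine irreducible_of_totalDegree_eq_one
    ((linForm_isHomogeneous e r).totalDegree (linForm_ne_zero hN e r)) fun x hx => ?_
  have h1 := hx (Finsupp.single ⟨0, hN⟩ 1)
  rw [coeff_linForm] at h1
  simp only [mul_zero, pow_zero] at h1
  exact isUnit_of_dvd_one h1

theorem linForm_isRelPrime (hN : 2 ≤ N) {e : K} (he : IsPrimitiveRoot e N) {r s : Fin N}
    (hrs : r ≠ s) : IsRelPrime (linForm e (fun j : Fin N => (j : ℕ)) r)
      (linForm e (fun j : Fin N => (j : ℕ)) s) := by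
  have hN' : 0 < N := by omega
  refine ((linForm_irreducible hN' e r).isRelPrime_iff_not_dvd).2 fun hdvd => ?_
  obtain ⟨u, hu⟩ := (linForm_irreducible hN' e r).dvd_symm (linForm_irreducible hN' e s) hdvd
  have hunit : IsUnit u := ((linForm_irreducible hN' e r).isUnit_or_isUnit hu).resolve_left
    (linForm_irreducible hN' e s).not_isUnit
  obtain ⟨c, -, rfl⟩ := (MvPolynomial.isUnit_iff_eq_C_of_isReduced).1 hunit
  have h0 := congrArg (coeff (Finsupp.single ⟨0, hN'⟩ 1)) hu
  have h1 := congrArg (coeff (Finsupp.single ⟨1, by omega⟩ 1)) hu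
  rw [mul_comm, coeff_C_mul, coeff_linForm, coeff_linForm] at h0 h1
  simp only [mul_zero, pow_zero, mul_one] at h0 h1
  rw [← h0, one_mul] at h1
  exact hrs (Fin.ext (he.pow_inj r.2 s.2 h1))

theorem diagonalAction_linForm (e : K) (r s : ℕ) :
    diagonalAction (e ^ s) (fun j : Fin N => (j : ℕ)) (linForm e (fun j : Fin N => (j : ℕ)) r) =
      linForm e (fun j : Fin N => (j : ℕ)) (r + s) := by
  rw [linForm, linForm, map_sum]
  refine Finset.sum_congr rfl fun j _ => ?_
  rw [diagonalAction, map_mul, aeval_X, algHom_C, algebraMap_eq, ← mul_assoc, ← C_mul]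
  ring_nf

theorem diagonalAction_circulantForm (hN : 0 < N) {e : K} (he : IsPrimitiveRoot e N) :
    diagonalAction e (fun j : Fin N => (j : ℕ)) (circulantForm N e) = circulantForm N e := by
  have h1 : ∀ r, diagonalAction e (fun j : Fin N => (j : ℕ))
      (linForm e (fun j : Fin N => (j : ℕ)) r) =
      linForm e (fun j : Fin N => (j : ℕ)) (r + 1) := fun r => by
    have := diagonalAction_linForm (N := N) e r 1
    rwa [pow_one] at this
  rw [circulantForm, map_prod]
  simp_rw [h1]
  rw [Fin.prod_univ_eq_prod_range (fun r => linForm e (fun j : Fin N => (j : ℕ)) (r + 1)) N,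
    Fin.prod_univ_eq_prod_range (fun r => linForm e (fun j : Fin N => (j : ℕ)) r) N]
  refine mul_right_cancel₀ (linForm_ne_zero hN e 0) ?_
  rw [← Finset.prod_range_succ', Finset.prod_range_succ]
  congr 1
  simp [linForm, pow_mul, he.pow_eq_one]

/-- The exponent vectors of the invariant monomials of degree `N`. -/
noncomputable def invariantExponents (N : ℕ) : Finset (Fin N →₀ ℕ) :=
  ((Finset.univ : Finset (Fin N)).finsuppAntidiag N).filter
    fun m => N ∣ Finsupp.weight (fun j : Fin N => (j : ℕ)) m

theorem mem_invariantExponents {m : Fin N →₀ ℕ} :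
    m ∈ invariantExponents N ↔
      m.degree = N ∧ N ∣ Finsupp.weight (fun j : Fin N => (j : ℕ)) m := by
  rw [invariantExponents, Finset.mem_filter, mem_finsuppAntidiag_univ]

theorem gtSystem_eq_monomialIdeal {e : K} (he : IsPrimitiveRoot e N) :
    gtSystem e N (fun j : Fin N => (j : ℕ)) =
      monomialIdeal K (invariantExponents N : Set (Fin N →₀ ℕ)) := by
  refine le_antisymm (Ideal.span_le.2 ?_) (Ideal.span_mono ?_)
  · rintro F ⟨hF, hinv⟩
    refine (mem_monomialIdeal_of_isHomogeneous
      (fun s hs => (mem_invariantExponents.1 hs).1) hF).2 fun m hm =>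
        mem_invariantExponents.2 ⟨?_, ?_⟩
    · by_contra hne
      exact hm (hF.coeff_eq_zero hne)
    · have h := coeff_diagonalAction e (fun j : Fin N => (j : ℕ)) F m
      rw [hinv, right_eq_mul₀ hm] at h
      exact (he.pow_eq_one_iff_dvd _).1 h
  · rintro _ ⟨m, hm, rfl⟩
    obtain ⟨hd, hw⟩ := mem_invariantExponents.1 hm
    refine ⟨isHomogeneous_monomial _ hd, ?_⟩
    ext u
    rw [coeff_diagonalAction, coeff_monomial]
    split_ifs with hu
    · rw [← hu, (he.pow_eq_one_iff_dvd _).2 hw, one_mul]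
    · rw [mul_zero]

theorem coeff_circulantForm_ne_zero_imp (hN : 0 < N) {e : K} (he : IsPrimitiveRoot e N)
    {m : Fin N →₀ ℕ} (hm : coeff m (circulantForm N e) ≠ 0) : m ∈ invariantExponents N := by
  refine mem_invariantExponents.2 ⟨?_, ?_⟩
  · by_contra hne
    exact hm ((circulantForm_isHomogeneous e).coeff_eq_zero hne)
  · have h := coeff_diagonalAction e (fun j : Fin N => (j : ℕ)) (circulantForm N e) m
    rw [diagonalAction_circulantForm hN he, right_eq_mul₀ hm] at h
    exact (he.pow_eq_one_iff_dvd _).1 h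

/-- Expansion of the coefficients of the circulant determinant along an arbitrary variable `x_t`,
after a cyclic shift of the weights that gives this variable weight `N`. -/
theorem coeff_circulantForm_eq {e : K} (he : IsPrimitiveRoot e N) (t : Fin N) {m : Fin N →₀ ℕ}
    (hm : m.degree = N) :
    coeff m (circulantForm N e) = (∏ r : Fin N, e ^ ((r : ℕ) * t)) *
      coeff (m.erase t) (truncEsymm N e (fun j : Fin N => (j : ℕ) + (N - t)) t
        (m.erase t).degree) := by
  have ht := t.2
  rw [← coeff_prod_linForm he.pow_eq_one (w := fun j : Fin N => (j : ℕ) + (N - t))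
    (by rw [Nat.add_sub_cancel' ht.le]) hm, ← coeff_C_mul, circulantForm, map_prod,
    ← Finset.prod_mul_distrib]
  congr 1
  refine Finset.prod_congr rfl fun r _ => ?_
  rw [linForm, linForm, Finset.mul_sum]
  refine Finset.sum_congr rfl fun j _ => ?_
  rw [← mul_assoc, ← C_mul, ← pow_add, ← mul_add,
    show (t : ℕ) + ((j : ℕ) + (N - t)) = j + N by omega, mul_add, pow_add, mul_comm (r : ℕ) N,
    pow_mul e N, he.pow_eq_one, one_pow, mul_one]

theorem weight_shift (t : Fin N) (m : Fin N →₀ ℕ) :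
    Finsupp.weight (fun j : Fin N => (j : ℕ) + (N - t)) m =
      Finsupp.weight (fun j : Fin N => (j : ℕ)) m + m.degree * (N - t) := by
  simp only [Finsupp.weight_apply, Finsupp.degree_eq_sum]
  rw [Finsupp.sum_fintype _ _ (by simp), Finsupp.sum_fintype _ _ (by simp), Finset.sum_mul,
    ← Finset.sum_add_distrib]
  simp [mul_add]

theorem coeff_circulantForm_ne_zero_of_isPrimePow [CharZero K] (hN : IsPrimePow N) {e : K}
    (he : IsPrimitiveRoot e N) {m : Fin N →₀ ℕ} (hm : m ∈ invariantExponents N) :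
    coeff m (circulantForm N e) ≠ 0 := by
  obtain ⟨hd, hw⟩ := mem_invariantExponents.1 hm
  obtain ⟨t, ht⟩ : ∃ t, m t ≠ 0 := by
    by_contra! hc
    have : m = 0 := Finsupp.ext hc
    rw [this, map_zero] at hd
    exact hN.ne_zero hd.symm
  rw [coeff_circulantForm_eq he t hd]
  have he0 : e ≠ 0 := he.ne_zero hN.ne_zero
  refine mul_ne_zero (Finset.prod_ne_zero_iff.2 fun r _ => pow_ne_zero _ he0) ?_
  have hdeg : (m.erase t).degree + m t = N := by
    conv_rhs => rw [← hd, ← Finsupp.erase_add_single t m, map_add, Finsupp.degree_single]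
  have hwt : N ∣ Finsupp.weight (fun j : Fin N => (j : ℕ) + (N - t)) (m.erase t) := by
    have h1 : N ∣ Finsupp.weight (fun j : Fin N => (j : ℕ) + (N - t)) m := by
      rw [weight_shift, hd]
      exact dvd_add hw (dvd_mul_right _ _)
    rw [← Finsupp.erase_add_single t m, map_add, Finsupp.weight_single,
      Nat.add_sub_cancel' t.2.le, smul_eq_mul] at h1
    exact (Nat.dvd_add_left (dvd_mul_left _ _)).1 h1
  obtain ⟨p, r, hp, -, rfl⟩ := (isPrimePow_nat_iff _).1 hN
  have : Fact p.Prime := ⟨hp⟩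
  exact coeff_truncEsymm_ne_zero he _ (by simp) hwt (by omega)

theorem exists_coeff_circulantForm_eq_zero (hN : 2 ≤ N) (h : ¬ IsPrimePow N) {e : K}
    (he : IsPrimitiveRoot e N) :
    ∃ m ∈ invariantExponents N, coeff m (circulantForm N e) = 0 := by
  have hζ := Complex.isPrimitiveRoot_exp N (by omega)
  set t : Fin N := ⟨0, by omega⟩
  obtain ⟨m, hmt, hmd, hmw, hm⟩ := exists_coeff_truncEsymm_eq_zero hN h hζ t rfl
  have herase : (m + Finsupp.single t (N - m.degree)).erase t = m := by
    ext i
    by_cases hi : i = t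
    · rw [hi, Finsupp.erase_same, hmt]
    · rw [Finsupp.erase_ne hi, Finsupp.add_apply, Finsupp.single_eq_of_ne hi, add_zero]
  have hdeg : (m + Finsupp.single t (N - m.degree)).degree = N := by
    rw [map_add, Finsupp.degree_single]
    omega
  refine ⟨m + Finsupp.single t (N - m.degree), mem_invariantExponents.2 ⟨hdeg, ?_⟩,
    coeff_circulantForm_eq_zero_of_charZero (by omega) hζ he ?_⟩
  · rw [map_add, Finsupp.weight_single]
    simpa [t] using hmw
  · rw [circulantForm, coeff_prod_linForm hζ.pow_eq_one
    (w := fun j : Fin N => (j : ℕ)) (t := t) (dvd_zero N) hdeg, herase, hm]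

end Circulant

/-! ### The number of invariant monomials -/

section Counting

variable {N : ℕ}

/-- Every monomial of degree `N - 1` has exactly one invariant multiple of degree `N` by a
variable; counting these pairs from the invariant monomials gives the sum of their support sizes. -/
theorem sum_card_support_le (hN : 1 ≤ N) :
    ∑ m ∈ invariantExponents N, m.support.card ≤ (2 * N - 2).choose (N - 1) := by
  rw [← Finset.card_sigma, show 2 * N - 2 = N + (N - 1) - 1 by omega,
    ← card_finsuppAntidiag_univ]
  refine Finset.card_le_card_of_injOn (fun x => x.1 - Finsupp.single x.2 1) ?_ ?_
  · rintro ⟨m, i⟩ hx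
    obtain ⟨hm, hi⟩ := Finset.mem_sigma.1 hx
    have hle : Finsupp.single i 1 ≤ m := by
      rw [Finsupp.single_le_iff]
      exact Nat.one_le_iff_ne_zero.2 (Finsupp.mem_support_iff.1 hi)
    refine Finset.mem_coe.2 (mem_finsuppAntidiag_univ.2 ?_)
    have h := congrArg Finsupp.degree (tsub_add_cancel_of_le hle)
    rw [map_add, Finsupp.degree_single, (mem_invariantExponents.1 hm).1] at h
    simp only
    omega
  · rintro ⟨m, i⟩ hx ⟨m', i'⟩ hx' heq
    obtain ⟨hm, hi⟩ := Finset.mem_sigma.1 hx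
    obtain ⟨hm', hi'⟩ := Finset.mem_sigma.1 hx'
    simp only at heq hm hi hm' hi'
    -- The removed index is determined modulo `N` by the weight of what remains.
    have key : ∀ {m : Fin N →₀ ℕ} {i : Fin N}, m ∈ invariantExponents N → i ∈ m.support →
        (m - Finsupp.single i 1 + Finsupp.single i 1 = m) ∧
        N ∣ Finsupp.weight (fun j : Fin N => (j : ℕ)) (m - Finsupp.single i 1) + i := by
      intro m i hm hi
      have hle : Finsupp.single i 1 ≤ m := by
        rw [Finsupp.single_le_iff]
        exact Nat.one_le_iff_ne_zero.2 (Finsupp.mem_support_iff.1 hi)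
      refine ⟨tsub_add_cancel_of_le hle, ?_⟩
      have h := (mem_invariantExponents.1 hm).2
      rw [← tsub_add_cancel_of_le hle, map_add, Finsupp.weight_single, one_smul] at h
      exact h
    obtain ⟨h1, h2⟩ := key hm hi
    obtain ⟨h3, h4⟩ := key hm' hi'
    rw [heq] at h1 h2
    have hmod : (i : ℕ) ≡ i' [MOD N] := by
      refine Nat.ModEq.add_left_cancel' (Finsupp.weight (fun j : Fin N => (j : ℕ))
        (m' - Finsupp.single i' 1)) ?_
      exact ((Nat.modEq_zero_iff_dvd).2 h2).trans ((Nat.modEq_zero_iff_dvd).2 h4).symm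
    have hii : i = i' := Fin.ext (Nat.ModEq.eq_of_lt_of_lt hmod i.2 i'.2)
    subst hii
    rw [h1] at h3
    rw [h3]

theorem two_mul_card_invariantExponents_le (hN : 1 ≤ N) :
    2 * (invariantExponents N).card ≤ (2 * N - 2).choose (N - 1) + N := by
  -- Only the `N` pure powers have fewer than two variables.
  have h1 : ((invariantExponents N).filter fun m => m.support.card ≤ 1).card ≤ N := by
    have hsub : (invariantExponents N).filter (fun m => m.support.card ≤ 1) ⊆
        Finset.univ.image fun i : Fin N => Finsupp.single i N := by
      intro m hm
      rw [Finset.mem_filter] at hm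
      have hd := (mem_invariantExponents.1 hm.1).1
      have : Nonempty (Fin N) := ⟨⟨0, hN⟩⟩
      obtain ⟨i, b, rfl⟩ := Finsupp.card_support_le_one'.1 hm.2
      rw [Finsupp.degree_single] at hd
      rw [Finset.mem_image]
      exact ⟨i, Finset.mem_univ i, by rw [hd]⟩
    refine (Finset.card_le_card hsub).trans (Finset.card_image_le.trans ?_)
    rw [Finset.card_univ, Fintype.card_fin]
  have h2 : 2 * (invariantExponents N).card ≤ ∑ m ∈ invariantExponents N, m.support.card +
      ((invariantExponents N).filter fun m => m.support.card ≤ 1).card := by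
    rw [Finset.card_filter, ← Finset.sum_add_distrib, mul_comm, ← smul_eq_mul]
    refine Finset.card_nsmul_le_sum _ _ _ fun m hm => ?_
    have h3 : m.support.card ≠ 0 := by
      intro h
      rw [Finset.card_eq_zero, Finsupp.support_eq_empty] at h
      have hd := (mem_invariantExponents.1 hm).1
      rw [h, map_zero] at hd
      omega
    split_ifs <;> omega
  have := sum_card_support_le hN
  omega

theorem card_invariantExponents_le (hN : 3 ≤ N) :
    (invariantExponents N).card ≤ (N + N - 2).choose (N - 2) := by
  have h := two_mul_card_invariantExponents_le (show 1 ≤ N by omega)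
  rw [show N + N - 2 = 2 * N - 2 by omega]
  obtain ⟨n, rfl⟩ : ∃ n, N = n + 3 := ⟨N - 3, by omega⟩
  rw [show 2 * (n + 3) - 2 = 2 * (n + 2) by omega, Nat.add_sub_cancel_right (n := n + 2) (m := 1)]
    at *
  have h1 := Nat.choose_succ_right_eq (2 * (n + 2)) (n + 1)
  rw [show 2 * (n + 2) - (n + 1) = n + 3 by omega, show n + 1 + 1 = n + 2 by omega] at h1
  rw [show n + 3 - 2 = n + 1 by omega]
  set B := (2 * (n + 2)).choose (n + 2)
  set T := (2 * (n + 2)).choose (n + 1)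
  set c := (invariantExponents (n + 3)).card
  rcases Nat.eq_zero_or_pos n with rfl | hn
  · have hB : B = 6 := by decide
    have hT : T = 4 := by decide
    omega
  · have hB : 2 * (n + 3) ≤ B := by
      have h2 : (2 * (n + 2)).choose 2 ≤ B := Nat.choose_le_centralBinom 2 (n + 2)
      rw [Nat.choose_two_right, show 2 * (n + 2) - 1 = 2 * n + 3 by omega, mul_assoc,
        Nat.mul_div_cancel_left _ two_pos] at h2
      nlinarith
    have : (n + 3) * (2 * c) ≤ (n + 3) * (2 * T) := by nlinarith
    have := Nat.le_of_mul_le_mul_left this (by omega)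
    omega

end Counting

/-! ### Failure of the Weak Lefschetz Property -/

section WeakLefschetz

variable {K : Type*} [Field K] {N : ℕ}

theorem eq_sum_of_isHomogeneous_one {n : ℕ} {p : MvPolynomial (Fin n) K} (hp : p.IsHomogeneous 1) :
    p = ∑ j, C (coeff (Finsupp.single j 1) p) * X j := by
  ext m
  rw [coeff_sum]
  simp_rw [coeff_C_mul, coeff_X]
  by_cases hm : m.degree = 1
  · obtain ⟨i, rfl⟩ := (Finsupp.sum_eq_one_iff m).1 hm
    rw [Finset.sum_eq_single i]
    · simp
    · intro j _ hj
      rw [if_neg fun h => hj (Finsupp.single_left_injective one_ne_zero h), mul_zero]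
    · exact fun h => absurd (Finset.mem_univ i) h
  · rw [hp.coeff_eq_zero hm]
    refine (Finset.sum_eq_zero fun j _ => ?_).symm
    rw [if_neg, mul_zero]
    rintro rfl
    exact hm (Finsupp.degree_single _ _)

theorem not_injective_mulMap {n j d : ℕ} {S : Set (Fin n →₀ ℕ)}
    (hS : ∀ s ∈ S, s.degree = d) (hj : j < d) (L : gradedPiece (monomialIdeal K S) 1)
    {p q : MvPolynomial (Fin n) K} (hp : Ideal.Quotient.mkₐ K (monomialIdeal K S) p = L)
    (hq : q.IsHomogeneous j) (hq0 : q ≠ 0) (hpq : p * q ∈ monomialIdeal K S) :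
    ¬ Function.Injective (mulMap _ L j) := by
  intro hinj
  have h0 : mulMap _ L j ⟨Ideal.Quotient.mkₐ K (monomialIdeal K S) q, q, hq, rfl⟩ = 0 := by
    refine Subtype.ext ?_
    change (L : MvPolynomial (Fin n) K ⧸ monomialIdeal K S) *
      Ideal.Quotient.mkₐ K (monomialIdeal K S) q = 0
    rw [← hp, ← map_mul, Ideal.Quotient.mkₐ_eq_mk, Ideal.Quotient.eq_zero_iff_mem]
    exact hpq
  have h1 := congrArg Subtype.val (hinj (h0.trans (map_zero _).symm))
  change Ideal.Quotient.mkₐ K (monomialIdeal K S) q = 0 at h1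
  rw [Ideal.Quotient.mkₐ_eq_mk, Ideal.Quotient.eq_zero_iff_mem] at h1
  exact notMem_monomialIdeal_of_isHomogeneous hS hj hq hq0 h1

/-- If all the monomials of the circulant determinant are among the generators, then every linear
form is killed by the product of its other conjugates, and the Weak Lefschetz Property fails. -/
theorem isMonomialTogliattiSystem_of_support_subset (hN : 3 ≤ N) {e : K}
    (he : IsPrimitiveRoot e N) {S : Finset (Fin N →₀ ℕ)} (hS : S ⊆ invariantExponents N)
    (hsupp : ∀ m, coeff m (circulantForm N e) ≠ 0 → m ∈ S) :
    IsMonomialTogliattiSystem (monomialIdeal K (S : Set (Fin N →₀ ℕ))) N := by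
  have hSd : ∀ s ∈ (S : Set (Fin N →₀ ℕ)), s.degree = N := fun s hs =>
    (mem_invariantExponents.1 (hS hs)).1
  have hcard : S.card ≤ (N + N - 2).choose (N - 2) :=
    (Finset.card_le_card hS).trans (card_invariantExponents_le hN)
  refine ⟨⟨?_, ⟨S.card, fun i => monomial (S.equivFin.symm i).1 1, ?_, ?_, hcard⟩, ?_⟩, S, rfl⟩
  -- The circulant determinant contains the pure powers, with a power of `e` as coefficient.
  · refine isArtinianRing_quotient_monomialIdeal (d := N) (by omega) fun i => hsupp _ ?_
    rw [coeff_circulantForm_eq he i (Finsupp.degree_single _ _), Finsupp.erase_single]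
    have he0 : e ≠ 0 := he.ne_zero (by omega)
    refine mul_ne_zero (Finset.prod_ne_zero_iff.2 fun r _ => pow_ne_zero _ he0) ?_
    simp [truncEsymm]
  · exact fun i => isHomogeneous_monomial _ (hSd _ (S.equivFin.symm i).2)
  · rw [monomialIdeal]
    congr 1
    ext F
    constructor
    · rintro ⟨i, rfl⟩
      exact ⟨_, (S.equivFin.symm i).2, rfl⟩
    · rintro ⟨m, hm, rfl⟩
      exact ⟨S.equivFin ⟨m, hm⟩, by simp⟩
  · intro L
    suffices h : ¬ Function.Injective (mulMap _ L (N - 1)) by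
      rintro (h1 | h1)
      · exact h h1
      · exact h (injective_of_surjective_mulMap (by omega) (by omega) hSd hcard L h1)
    obtain ⟨p, hp, hpL⟩ := L.2
    have hp : p.IsHomogeneous 1 := hp
    -- For `L = 0` any nonzero form of degree `N - 1` is in the kernel.
    by_cases hp0 : p = 0
    · refine not_injective_mulMap hSd (by omega) L hpL
        (isHomogeneous_X_pow (⟨0, by omega⟩ : Fin N) (N - 1)) (pow_ne_zero _ (X_ne_zero _)) ?_
      rw [hp0, zero_mul]
      exact Ideal.zero_mem _
    set a : Fin N → K := fun j => coeff (Finsupp.single j 1) p with ha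
    set φ : MvPolynomial (Fin N) K →ₐ[K] MvPolynomial (Fin N) K :=
      aeval (fun i => C (a i) * X i) with hφ
    have hφl : ∀ r : ℕ, φ (linForm e (fun j : Fin N => (j : ℕ)) r) =
        diagonalAction (e ^ r) (fun j : Fin N => (j : ℕ)) p := by
      intro r
      rw [eq_sum_of_isHomogeneous_one hp, linForm, map_sum, map_sum]
      refine Finset.sum_congr rfl fun j _ => ?_
      rw [hφ, diagonalAction, map_mul, map_mul, aeval_X, aeval_X, algHom_C, algHom_C, ← pow_mul]
      simp only [algebraMap_eq, ha]
      ring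
    have hφ0 : φ (linForm e (fun j : Fin N => (j : ℕ)) 0) = p := by
      rw [hφl]
      ext m
      rw [coeff_diagonalAction, pow_zero, one_pow, one_mul]
    have hφhom : ∀ r : ℕ, (φ (linForm e (fun j : Fin N => (j : ℕ)) r)).IsHomogeneous 1 :=
      fun r => (linForm_isHomogeneous e r).aeval _ fun i => (isHomogeneous_X K i).C_mul _
    have hφne : ∀ r : ℕ, φ (linForm e (fun j : Fin N => (j : ℕ)) r) ≠ 0 := by
      intro r h
      obtain ⟨m, hm⟩ := ne_zero_iff.1 hp0
      have h1 := congrArg (coeff m) h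
      rw [hφl, coeff_diagonalAction, coeff_zero] at h1
      exact mul_ne_zero (pow_ne_zero _ (pow_ne_zero _ (he.ne_zero (by omega)))) hm h1
    set i0 : Fin N := ⟨0, by omega⟩ with hi0
    refine not_injective_mulMap hSd (by omega) L hpL
      (q := ∏ r ∈ Finset.univ.erase i0, φ (linForm e (fun j : Fin N => (j : ℕ)) (r : Fin N)))
      ?_ (Finset.prod_ne_zero_iff.2 fun r _ => hφne r) ?_
    · have h := IsHomogeneous.prod (Finset.univ.erase i0)
        (fun r : Fin N => φ (linForm e (fun j : Fin N => (j : ℕ)) r)) (fun _ => 1)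
        fun r _ => hφhom r
      rwa [Finset.sum_const, Finset.card_erase_of_mem (Finset.mem_univ _), Finset.card_univ,
        Fintype.card_fin, smul_eq_mul, mul_one] at h
    · have hprod : p * ∏ r ∈ Finset.univ.erase i0,
          φ (linForm e (fun j : Fin N => (j : ℕ)) (r : Fin N)) = φ (circulantForm N e) := by
        rw [circulantForm, map_prod, ← Finset.mul_prod_erase _ _ (Finset.mem_univ i0)]
        congr 1
        exact hφ0.symm
      rw [hprod, mem_monomialIdeal]
      intro m hm
      rw [mem_support_iff, hφ, coeff_aeval_C_mul_X] at hm
      exact ⟨m, hsupp m (right_ne_zero_of_mul hm), le_rfl⟩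

/-- A form of degree `N` that is invariant and divisible by `∑ j, x_j` is divisible by all the
conjugates of this linear form, hence a multiple of the circulant determinant. -/
theorem exists_eq_C_mul_circulantForm (hN : 2 ≤ N) {e : K} (he : IsPrimitiveRoot e N)
    {h : MvPolynomial (Fin N) K} (hh : h.IsHomogeneous N)
    (hinv : ∀ m, coeff m h ≠ 0 → m ∈ invariantExponents N)
    (hdvd : linForm e (fun j : Fin N => (j : ℕ)) 0 ∣ h) :
    ∃ c : K, h = C c * circulantForm N e := by
  have hall : ∀ r : Fin N, linForm e (fun j : Fin N => (j : ℕ)) r ∣ h := by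
    intro r
    have h1 := map_dvd (diagonalAction (e ^ (r : ℕ)) (fun j : Fin N => (j : ℕ))) hdvd
    have h2 : diagonalAction (e ^ (r : ℕ)) (fun j : Fin N => (j : ℕ)) h = h := by
      ext m
      rw [coeff_diagonalAction]
      by_cases hm : coeff m h = 0
      · rw [hm, mul_zero]
      · rw [← pow_mul, (he.pow_eq_one_iff_dvd _).2
          ((mem_invariantExponents.1 (hinv m hm)).2.mul_left _), one_mul]
    rwa [h2, diagonalAction_linForm, zero_add] at h1
  obtain ⟨g, hg⟩ : circulantForm N e ∣ h :=
    Fintype.prod_dvd_of_isRelPrime (fun r s hrs => linForm_isRelPrime hN he hrs) hall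
  by_cases hg0 : g = 0
  · exact ⟨0, by rw [hg, hg0, mul_zero, C_0, zero_mul]⟩
  have hD0 : circulantForm N e ≠ 0 :=
    Finset.prod_ne_zero_iff.2 fun r _ => linForm_ne_zero (by omega) e r
  have hdeg := totalDegree_mul_of_isDomain hD0 hg0
  rw [← hg, hh.totalDegree (hg ▸ mul_ne_zero hD0 hg0),
    (circulantForm_isHomogeneous e).totalDegree hD0] at hdeg
  obtain ⟨c, hc⟩ : ∃ c, g = C c := ⟨_, totalDegree_eq_zero_iff_eq_C.1 (by omega)⟩
  exact ⟨c, by rw [hg, hc, mul_comm]⟩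

/-- If an ideal generated by invariant monomials fails the Weak Lefschetz Property, then every
monomial of the circulant determinant is among its generators. -/
theorem mem_of_failsWLPInDegree (hN : 2 ≤ N) {e : K} (he : IsPrimitiveRoot e N)
    {S : Set (Fin N →₀ ℕ)} (hS : ∀ s ∈ S, s ∈ invariantExponents N)
    (hfail : FailsWLPInDegree (monomialIdeal K S) (N - 1)) {m : Fin N →₀ ℕ}
    (hm : coeff m (circulantForm N e) ≠ 0) : m ∈ S := by
  set J := monomialIdeal K S
  set l := linForm e (fun j : Fin N => (j : ℕ)) 0
  have hl : l.IsHomogeneous 1 := linForm_isHomogeneous e 0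
  set L : gradedPiece J 1 := ⟨Ideal.Quotient.mkₐ K J l, l, hl, rfl⟩
  have hninj : ¬ Function.Injective (mulMap J L (N - 1)) := fun h => hfail L (Or.inl h)
  rw [injective_iff_map_eq_zero] at hninj
  push Not at hninj
  obtain ⟨⟨_, q, hq, rfl⟩, hq1, hq2⟩ := hninj
  have hq : q.IsHomogeneous (N - 1) := hq
  have hq0 : q ≠ 0 := by
    rintro rfl
    exact hq2 (Subtype.ext (map_zero (Ideal.Quotient.mkₐ K J)))
  have hmem : l * q ∈ J := by
    have h1 := congrArg Subtype.val hq1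
    change Ideal.Quotient.mkₐ K J l * Ideal.Quotient.mkₐ K J q = 0 at h1
    rwa [← map_mul, Ideal.Quotient.mkₐ_eq_mk, Ideal.Quotient.eq_zero_iff_mem] at h1
  have hhom : (l * q).IsHomogeneous N := by
    have := hl.mul hq
    rwa [show 1 + (N - 1) = N by omega] at this
  have hsub := (mem_monomialIdeal_of_isHomogeneous
    (fun s hs => (mem_invariantExponents.1 (hS s hs)).1) hhom).1 hmem
  obtain ⟨c, hc⟩ := exists_eq_C_mul_circulantForm hN he hhom (fun m hm => hS m (hsub m hm))
    (dvd_mul_right l q)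
  refine hsub m ?_
  rw [hc, coeff_C_mul]
  refine mul_ne_zero ?_ hm
  rintro rfl
  rw [C_0, zero_mul] at hc
  exact mul_ne_zero (linForm_ne_zero (by omega) e 0) hq0 hc

/-- The GT-system is minimal exactly when no coefficient of the circulant determinant at an
invariant monomial vanishes. -/
theorem isMinimal_gtSystem_iff (hN : 3 ≤ N) {e : K} (he : IsPrimitiveRoot e N) :
    IsMinimalMonomialTogliattiSystem (gtSystem e N (fun j : Fin N => (j : ℕ))) N ↔
      ∀ m ∈ invariantExponents N, coeff m (circulantForm N e) ≠ 0 := by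
  have hgen : minimalMonomialGenerators (gtSystem e N (fun j : Fin N => (j : ℕ))) =
      (invariantExponents N : Set (Fin N →₀ ℕ)) := by
    rw [gtSystem_eq_monomialIdeal he]
    exact minimalMonomialGenerators_monomialIdeal fun s hs => (mem_invariantExponents.1 hs).1
  rw [IsMinimalMonomialTogliattiSystem, hgen]
  constructor
  · rintro ⟨-, hmin⟩ m hm h0
    classical
    refine hmin (((invariantExponents N).erase m : Finset (Fin N →₀ ℕ)) : Set (Fin N →₀ ℕ))
      (Finset.coe_ssubset.2 (Finset.erase_ssubset hm))
      (isMonomialTogliattiSystem_of_support_subset hN he (Finset.erase_subset _ _)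
        fun m' hm' => Finset.mem_erase.2
          ⟨fun h => hm' (h ▸ h0), coeff_circulantForm_ne_zero_imp (by omega) he hm'⟩)
  · intro hall
    refine ⟨?_, fun S hS hT => hS.2 fun m hm => ?_⟩
    · rw [gtSystem_eq_monomialIdeal he]
      exact isMonomialTogliattiSystem_of_support_subset hN he subset_rfl
        fun m hm => coeff_circulantForm_ne_zero_imp (by omega) he hm
    · exact mem_of_failsWLPInDegree (by omega) he (fun s hs => hS.1 hs) hT.1.2.2 (hall m hm)

end WeakLefschetz
end Togliatti

theorem theorem4p8 {K : Type*} [Field K] [IsAlgClosed K] (N : ℕ) (hN : 3 ≤ N)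
    (e : K) (he : IsPrimitiveRoot e N) :
    Togliatti.IsMonomialTogliattiSystem
        (Togliatti.gtSystem e N (fun i : Fin N => (i : ℕ))) N ∧
      (Togliatti.IsMinimalMonomialTogliattiSystem
        (Togliatti.gtSystem e N (fun i : Fin N => (i : ℕ))) N → IsPrimePow N) ∧
      (CharZero K →
        (Togliatti.IsMinimalMonomialTogliattiSystem
          (Togliatti.gtSystem e N (fun i : Fin N => (i : ℕ))) N ↔ IsPrimePow N)) := by
  have hpow : Togliatti.IsMinimalMonomialTogliattiSystem
      (Togliatti.gtSystem e N (fun i : Fin N => (i : ℕ))) N → IsPrimePow N := by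
    intro hmin
    by_contra hnot
    obtain ⟨m, hm, h0⟩ := Togliatti.exists_coeff_circulantForm_eq_zero (by omega) hnot he
    exact (Togliatti.isMinimal_gtSystem_iff hN he).1 hmin m hm h0
  refine ⟨?_, hpow, fun _ => ⟨hpow, fun hprime => ?_⟩⟩
  · rw [Togliatti.gtSystem_eq_monomialIdeal he]
    exact Togliatti.isMonomialTogliattiSystem_of_support_subset hN he subset_rfl
      fun m hm => Togliatti.coeff_circulantForm_ne_zero_imp (by omega) he hm
  · exact (Togliatti.isMinimal_gtSystem_iff hN he).2 fun m hm =>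
      Togliatti.coeff_circulantForm_ne_zero_of_isPrimePow hprime he hm
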